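/- Let $n\ge 2$ and $c_0>0$. Let $\Omega\subset\mathbb R^n$ be a $c_0$-John domain with center $x_0\in\Omega$ and $\operatorname{diam}\Omega=1$: that is, $\Omega$ is a bounded domain and every $x\in\Omega$ can be joined to $x_0$ by a rectifiable curve $\gamma:[0,l]\to\Omega$, parametrized by arc length, with $\gamma(0)=x$, $\gamma(l)=x_0$ and $d(\gamma(t),\partial\Omega)\ge t/c_0$ for all $t\in[0,l]$. Let $\mathscr W$ be a Whitney decomposition of $\Omega$: a collection of closed cubes with edges parallel to the coordinate axes and pairwise disjoint interiors, such that $\Omega=\bigcup_{Q\in\mathscr W}Q$, each $\operatorname{diam}Q$ is of the form $2^{-j}$ with $j\in\mathbb Z$, $\operatorname{diam}Q\le d(Q,\partial\Omega)\le 4\operatorname{diam}Q$, and for some $\lambda_0>1$ the dilated cubes $\lambda_0Q$ have uniformly bounded overlap. Let $Q_0\in\mathscr W$ be the central cube, i.e. a cube containing $x_0$. Let $E\subset\partial\Omega$ be a compact set with $\mathcal H^h(E)>0$, where $\mathcal H^h$ is the Hausdorff measure with gauge $h(t)=\log^{-n-1}(1/t)$. For a weight $w:\Omega\to[0,\infty]$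 put $$\operatorname{cap}_w(E,Q_0,\Omega)=\inf_u\int_\Omega|\nabla u|^n\,w\,dx,$$ where the infimum is over all $u\in W^{1,n}(\Omega)\cap C(\overline\Omega)$ with $u\le 0$ on $E$ and $u\ge 1$ on $Q_0$ (with the convention $0\cdot\infty=0$), and write $\operatorname{cap}=\operatorname{cap}_1$. Let $$\mathcal H^1_\infty(E)=\inf\Big\{\sum_i r_i:\ E\subset\bigcup_i B(x_i,r_i)\Big\},$$ the infimum being over countable coverings by balls (it is smaller than $1$ for such $E$; if it is $0$, the right-hand sides below are read as $0$). Then: (1) There is a constant $C>0$ depending only on $n$ and $c_0$ such that $$\operatorname{cap}(E,Q_0,\Omega)\ \ge\ C\Big(\log\frac1{\mathcal H^1_\infty(E)}\Big)^{1-n}.$$ (2) For all $\lambda>0$ and $L<\infty$ there is a constant $C>0$ depending only on $n,c_0,\lambda,L$ such that, for every measurable weight $\omega:\Omega\to[0,\infty]$ with $\int_\Omega\exp(\lambda\omega)\,dx\le L$, $$\operatorname{cap}_{1/\omega}(E,Q_0,\Omega)\ \ge\ C\Big(\log\frac1{\mathcal H^1_\infty(E)}\Big)^{-n},$$ where $1/0=\infty$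 and $1/\infty=0$. -/

import Mathlib

open MeasureTheory Set
open scoped ENNReal NNReal ContDiff

namespace JohnCapacity

/-! ### John domains -/

/-- `γ : [0, l] → Ω` is a `c`-John curve in `Ω` joining `x` to `x₀`: it is rectifiable and
parametrized by arc length, and `d(γ(t), ∂Ω) ≥ t / c` for all `t ∈ [0, l]`. -/
structure IsJohnCurve {n : ℕ} (c : ℝ) (Ω : Set (EuclideanSpace ℝ (Fin n)))
    (x x₀ : EuclideanSpace ℝ (Fin n)) (l : ℝ) (γ : ℝ → EuclideanSpace ℝ (Fin n)) : Prop where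
  length_nonneg : 0 ≤ l
  arcLength : HasUnitSpeedOn γ (Icc 0 l)
  mapsTo : MapsTo γ (Icc 0 l) Ω
  start : γ 0 = x
  finish : γ l = x₀
  john : ∀ t ∈ Icc 0 l, t / c ≤ Metric.infDist (γ t) (frontier Ω)

/-- `Ω` is a bounded domain which is `c`-John with center `x₀`. -/
structure IsJohnDomain {n : ℕ} (c : ℝ) (Ω : Set (EuclideanSpace ℝ (Fin n)))
    (x₀ : EuclideanSpace ℝ (Fin n)) : Prop where
  isOpen : IsOpen Ω
  isConnected : IsConnected Ω
  isBounded : Bornology.IsBounded Ω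
  center_mem : x₀ ∈ Ω
  exists_curve : ∀ x ∈ Ω, ∃ l γ, IsJohnCurve c Ω x x₀ l γ

/-! ### Whitney decompositions -/

/-- The data of a nondegenerate closed cube with edges parallel to the coordinate axes:
its center and half of its side length. -/
structure AxisCube (n : ℕ) where
  center : EuclideanSpace ℝ (Fin n)
  halfSide : ℝ
  halfSide_pos : 0 < halfSide

/-- The points of the closed cube obtained from `Q` by dilating it about its center
by the factor `a`. -/
def AxisCube.dilate {n : ℕ} (Q : AxisCube n) (a : ℝ) : Set (EuclideanSpace ℝ (Fin n)) :=
  {x | ∀ i, |x i - Q.center i| ≤ a * Q.halfSide}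

/-- The points of the closed cube `Q`. -/
def AxisCube.carrier {n : ℕ} (Q : AxisCube n) : Set (EuclideanSpace ℝ (Fin n)) :=
  Q.dilate 1

/-- The distance `d(A, B)` between two sets, the infimum of the distances of their points. -/
noncomputable def setDist {X : Type*} [PseudoEMetricSpace X] (A B : Set X) : ℝ≥0∞ :=
  ⨅ x ∈ A, Metric.infEDist x B

/-- `W` is a Whitney type decomposition of `Ω` into closed cubes. -/
structure IsWhitneyDecomposition {n : ℕ} (Ω : Set (EuclideanSpace ℝ (Fin n)))
    (W : Set (AxisCube n)) : Prop where
  iUnion_eq : ⋃ Q ∈ W, Q.carrier = Ω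
  disjoint_interior : ∀ Q ∈ W, ∀ Q' ∈ W, Q ≠ Q' →
    Disjoint (interior Q.carrier) (interior Q'.carrier)
  bounded_overlap : ∃ a : ℝ, 1 < a ∧ ∃ N : ℕ, ∀ x : EuclideanSpace ℝ (Fin n),
    {Q ∈ W | x ∈ Q.dilate a}.encard ≤ N
  dyadic_diam : ∀ Q ∈ W, ∃ j : ℤ, Metric.diam Q.carrier = (2 : ℝ) ^ (-j)
  diam_le_dist : ∀ Q ∈ W, Metric.ediam Q.carrier ≤ setDist Q.carrier (frontier Ω)
  dist_le_diam : ∀ Q ∈ W, setDist Q.carrier (frontier Ω) ≤ 4 * Metric.ediam Q.carrier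

/-! ### Hausdorff measure and content -/

/-- `log (1 / t)` for `t ∈ [0, 1]`, with `log (1 / 0) = ∞`; it is set to `0` for `t > 1`. -/
noncomputable def logInv (t : ℝ≥0∞) : ℝ≥0∞ := (ENNReal.log t⁻¹).toENNReal

/-- The gauge `h(t) = log^{-n-1}(1/t)`, with `h(0) = 0`. Only its values for small `t` matter for
the Hausdorff measure. -/
noncomputable def logGauge (n : ℕ) (t : ℝ≥0∞) : ℝ≥0∞ := logInv t ^ (-(n : ℝ) - 1)

/-- The Hausdorff measure `H^h` for the gauge `h(t) = log^{-n-1}(1/t)`. -/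
noncomputable def gaugeMeasure (n : ℕ) : Measure (EuclideanSpace ℝ (Fin n)) :=
  Measure.mkMetric (logGauge n)

/-- The one-dimensional Hausdorff content `H¹_∞(E)`, the infimum of `∑ rᵢ` over all coverings of
`E` by countably many balls `B(xᵢ, rᵢ)`. -/
noncomputable def hausdorffContentOne {n : ℕ} (E : Set (EuclideanSpace ℝ (Fin n))) : ℝ≥0∞ :=
  ⨅ (x : ℕ → EuclideanSpace ℝ (Fin n)) (r : ℕ → ℝ≥0)
    (_ : E ⊆ ⋃ i, Metric.ball (x i) (r i)), ∑' i, (r i : ℝ≥0∞)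

/-! ### Sobolev functions and capacity -/

/-- `u ∈ W^{1,n}(Ω)` with weak gradient `g`. -/
structure IsSobolevWithGradient {n : ℕ} (Ω : Set (EuclideanSpace ℝ (Fin n)))
    (u : EuclideanSpace ℝ (Fin n) → ℝ)
    (g : EuclideanSpace ℝ (Fin n) → EuclideanSpace ℝ (Fin n)) : Prop where
  memLp : MemLp u n (volume.restrict Ω)
  memLp_gradient : MemLp g n (volume.restrict Ω)
  weak_gradient : ∀ φ : EuclideanSpace ℝ (Fin n) → ℝ, ContDiff ℝ ∞ φ → HasCompactSupport φ →
    tsupport φ ⊆ Ω → ∀ v : EuclideanSpace ℝ (Fin n),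
      ∫ x in Ω, u x * fderiv ℝ φ x v = - ∫ x in Ω, inner ℝ (g x) v * φ x

/-- `u` is admissible for the capacity of the pair `(E, F)` in `Ω`, and `g` is its weak gradient:
`u ∈ W^{1,n}(Ω)` is continuous on the closure of `Ω`, with `u ≤ 0` on `E` and `u ≥ 1` on `F`. -/
structure IsAdmissible {n : ℕ} (E F Ω : Set (EuclideanSpace ℝ (Fin n)))
    (u : EuclideanSpace ℝ (Fin n) → ℝ)
    (g : EuclideanSpace ℝ (Fin n) → EuclideanSpace ℝ (Fin n)) : Prop where
  sobolev : IsSobolevWithGradient Ω u g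
  continuousOn : ContinuousOn u (closure Ω)
  le_zero : ∀ x ∈ E, u x ≤ 0
  one_le : ∀ x ∈ F, 1 ≤ u x

/-- The `w`-weighted `n`-capacity `cap_w(E, F, Ω) = inf_u ∫_Ω |∇u|ⁿ w dx`. -/
noncomputable def weightedCapacity {n : ℕ} (w : EuclideanSpace ℝ (Fin n) → ℝ≥0∞)
    (E F Ω : Set (EuclideanSpace ℝ (Fin n))) : ℝ≥0∞ :=
  ⨅ (u : EuclideanSpace ℝ (Fin n) → ℝ)
    (g : EuclideanSpace ℝ (Fin n) → EuclideanSpace ℝ (Fin n))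
    (_ : IsAdmissible E F Ω u g), ∫⁻ x in Ω, ‖g x‖ₑ ^ n * w x

/-- The unweighted `n`-capacity `cap(E, F, Ω)`. -/
noncomputable def capacity {n : ℕ} (E F Ω : Set (EuclideanSpace ℝ (Fin n))) : ℝ≥0∞ :=
  weightedCapacity (fun _ => 1) E F Ω

end JohnCapacity

/-!
The estimate is obtained by integrating a potential estimate for Sobolev functions against a
Frostman measure on `E`. Neither chains of Whitney cubes nor a Poincaré inequality is needed.

Write `d(z)` for the distance of `z` to `∂Ω`. Every point of `Ω` is joined to the centre `q` of the
central cube by a John curve `γ` (`IsJohnDomain.exists_curve_to_cube`). Consider the smooth averages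
of `u` over the balls of radius `t / (4 c)` about `γ t`. When the ball moves, the average changes by
at most the length of the motion times `r ^ (-n) ∫ |∇u|` over a slightly larger ball of
radius comparable to `r`: the derivative of the kernel along the motion is the divergence of a
compactly supported field, and the definition of the weak gradient applies to that field
(`IsSobolevWithGradient.abs_smoothAverage_sub_le`). Telescoping along a geometric progression of
values of `t`, starting near a point `a ∈ E` where `u ≤ 1 / 2` and ending in the cube where `u ≥ 1`,
gives

  `1 / 2 ≤ C ∫ |∇u| d(z) ^ (1 - n)`, the integral being over the `z` with `|z - a| ≤ A d(z)`,

because the balls that contain `z` have radii comparable to `d(z)`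
(`IsSobolevWithGradient.one_half_le_potential`). The curves start at a small distance from `a`, so
only points with `d(z) ≥ δ / A` enter. Hence a finitely supported measure on `E` with
`μ (B(x, r)) ≤ r` for `r ≥ δ` is good enough, and one of mass at least `H¹_∞(E) / 14` is found by a
finite-dimensional maximisation and Vitali's covering lemma (`exists_finite_frostman`).

Summing against this measure, of mass `M`, and applying Hölder's inequality with a weight `V`
(`half_mass_le_of_potential`) leaves, for each point `a` of `E`, the integral of
`|z - a| ^ (-n) min(M, A |z - a|) ^ s V ^ s` with `s = 1 / (n - 1)`. If `V ^ s` grows like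
`log ^ β (1 / |z - a|)`, up to a harmless error (`HasLogGrowth`), this integral is at most
`C M ^ s (1 + log (1 / M)) ^ (1 + β)` (`exists_lintegral_log_le`). The powers of `M` cancel, and
the energy is at least `C log ^ (-(1 + β)(n - 1)) (1 / H¹_∞(E))` (`exists_energy_lower_bound`).

The constant weight has `β = 0`, which gives the exponent `1 - n`. For an exponentially integrable
weight `ω` the choice is `V = ω + 1` and `β = s`, with exponent `-n`: where `V` exceeds a large
multiple of `log (1 / |z - a|)`, it is dominated by `|z - a| ^ n exp (λ V)`
(`rpow_le_log_add_exp`).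

If `H¹_∞(E) = 0` the right-hand sides vanish; otherwise `H¹_∞(E) ≤ 9 / 10`, so that the logarithm is
bounded below (`hausdorffContentOne_le_of_dist_le_one`).
-/

namespace JohnCapacity

/-! ### A discrete Frostman lemma -/

/-- Finitely many balls suffice as competitors for the Hausdorff content. -/
theorem hausdorffContentOne_le_sum {n : ℕ} {ι : Type*} (s : Finset ι)
    (x : ι → EuclideanSpace ℝ (Fin n)) (r : ι → ℝ≥0) (E : Set (EuclideanSpace ℝ (Fin n)))
    (hE : E ⊆ ⋃ i ∈ s, Metric.ball (x i) (r i)) :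
    hausdorffContentOne E ≤ ∑ i ∈ s, (r i : ℝ≥0∞) := by
  classical
  obtain ⟨e⟩ : Nonempty (Fin s.card ≃ s) := ⟨s.equivFin.symm⟩
  let x' : ℕ → EuclideanSpace ℝ (Fin n) := fun k => if h : k < s.card then x (e ⟨k, h⟩) else 0
  let r' : ℕ → ℝ≥0 := fun k => if h : k < s.card then r (e ⟨k, h⟩) else 0
  have hcov : E ⊆ ⋃ k, Metric.ball (x' k) (r' k) := by
    intro y hy
    obtain ⟨i, hi, hyi⟩ := mem_iUnion₂.1 (hE hy)
    refine mem_iUnion.2 ⟨(e.symm ⟨i, hi⟩).1, ?_⟩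
    have hx : x' (e.symm ⟨i, hi⟩).1 = x i := by simp [x']
    have hr : r' (e.symm ⟨i, hi⟩).1 = r i := by simp [r']
    rw [hx, hr]
    exact hyi
  unfold hausdorffContentOne
  refine iInf_le_of_le x' (iInf_le_of_le r' (iInf_le_of_le hcov ?_))
  rw [tsum_eq_sum (s := Finset.range s.card)
    (fun k hk => by simp [r', show ¬ k < s.card by simpa using hk]), Finset.sum_range,
    ← Finset.sum_coe_sort s, ← e.sum_comp]
  exact le_of_eq (Finset.sum_congr rfl fun i _ => by simp [r'])

/-- Among the weights on a finite set of points of a metric space that satisfy the growth condition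
`w(B(x, r)) ≤ r` for the balls of radius `r ≥ δ` centred at the points, those of maximal total mass
have every point contained in a ball for which equality holds. The growth condition persists with
the factor `2` for balls centred anywhere. -/
theorem exists_weights_tight {X ι : Type*} [PseudoMetricSpace X] [Fintype ι] (x : ι → X)
    {δ : ℝ} (hδ : 0 < δ) :
    ∃ w : ι → ℝ, (∀ i, 0 ≤ w i) ∧
      (∀ z r, δ ≤ r → ∑ i, (Metric.closedBall z r).indicator (fun _ => w i) (x i) ≤ 2 * r) ∧
      ∀ i, ∃ j, ∃ r, δ ≤ r ∧ x i ∈ Metric.closedBall (x j) r ∧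
        ∑ i, (Metric.closedBall (x j) r).indicator (fun _ => w i) (x i) = r := by
  classical
  let R : ι × ι → ℝ := fun p => max δ (dist (x p.1) (x p.2))
  have hR : ∀ p, δ ≤ R p := fun p => le_max_left _ _
  let m : (ι → ℝ) → ι × ι → ℝ := fun w p =>
    ∑ i, (Metric.closedBall (x p.1) (R p)).indicator (fun _ => w i) (x i)
  let K : Set (ι → ℝ) := (⋂ i, {w | 0 ≤ w i}) ∩ ⋂ p, {w | m w p ≤ R p}
  have hmc : ∀ p, Continuous fun w => m w p := by
    intro p
    refine continuous_finsetSum _ fun i _ => ?_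
    by_cases h : x i ∈ Metric.closedBall (x p.1) (R p)
    · simp only [indicator_of_mem h]; fun_prop
    · simp only [indicator_of_notMem h]; fun_prop
  have hK0 : ∀ {w}, w ∈ K → ∀ i, 0 ≤ w i := fun hw => mem_iInter.1 hw.1
  have hK1 : ∀ {w}, w ∈ K → ∀ p, m w p ≤ R p := fun hw => mem_iInter.1 hw.2
  have hind : ∀ {w : ι → ℝ}, (∀ i, 0 ≤ w i) → ∀ (s : Set X) (i : ι) (y : X),
      0 ≤ s.indicator (fun _ => w i) y :=
    fun hw s i y => indicator_nonneg (fun _ _ => hw i) y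
  have hKclosed : IsClosed K :=
    (isClosed_iInter fun i => isClosed_le continuous_const (continuous_apply i)).inter
      (isClosed_iInter fun p => isClosed_le (hmc p) continuous_const)
  have hKsub : K ⊆ Icc 0 (fun _ => δ) := by
    intro w hw
    refine ⟨fun i => hK0 hw i, fun i => ?_⟩
    have h2 : w i ≤ m w (i, i) := by
      have h4 : x i ∈ Metric.closedBall (x i) (R (i, i)) :=
        Metric.mem_closedBall_self (hδ.le.trans (hR _))
      calc w i = (Metric.closedBall (x i) (R (i, i))).indicator (fun _ => w i) (x i) := by
            rw [indicator_of_mem h4]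
        _ ≤ m w (i, i) := Finset.single_le_sum (f := fun j =>
            (Metric.closedBall (x i) (R (i, i))).indicator (fun _ => w j) (x j))
            (fun j _ => hind (hK0 hw) _ _ _) (Finset.mem_univ i)
    have h3 : R (i, i) = δ := by simp [R, hδ.le]
    linarith [hK1 hw (i, i)]
  have hKc : IsCompact K := isCompact_Icc.of_isClosed_subset hKclosed hKsub
  have hzero : (0 : ι → ℝ) ∈ K :=
    ⟨by simp, mem_iInter.2 fun p => by simpa [m] using hδ.le.trans (hR p)⟩
  obtain ⟨w, hwK, hwmax⟩ := hKc.exists_isMaxOn ⟨0, hzero⟩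
    (f := fun w : ι → ℝ => ∑ i, w i) (by fun_prop)
  refine ⟨w, hK0 hwK, fun z r hr => ?_, fun i => ?_⟩
  · -- A ball that meets the points is contained in a ball about one of them, of radius the distance
    -- to the farthest one in the ball.
    by_cases hne : ∃ i, x i ∈ Metric.closedBall z r
    · obtain ⟨i, hi⟩ := hne
      obtain ⟨j, hj, hjmax⟩ := (Finset.univ.filter fun j =>
        x j ∈ Metric.closedBall z r).exists_max_image
        (fun j => dist (x i) (x j)) ⟨i, by simpa using hi⟩
      simp only [Finset.mem_filter, Finset.mem_univ, true_and] at hj hjmax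
      have h2 : R (i, j) ≤ 2 * r := by
        refine max_le (by linarith) ?_
        have := dist_triangle_right (x i) (x j) z
        have h3 := Metric.mem_closedBall.1 hi
        have h4 := Metric.mem_closedBall.1 hj
        simp only; linarith
      refine le_trans (Finset.sum_le_sum fun k _ => ?_) ((hK1 hwK (i, j)).trans h2)
      by_cases hk : x k ∈ Metric.closedBall z r
      · have : x k ∈ Metric.closedBall (x i) (R (i, j)) := by
          rw [Metric.mem_closedBall, dist_comm]
          exact (hjmax k hk).trans (le_max_right _ _)
        rw [indicator_of_mem hk, indicator_of_mem this]
      · rw [indicator_of_notMem hk]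
        exact hind (hK0 hwK) _ _ _
    · rw [Finset.sum_eq_zero fun k _ => indicator_of_notMem (fun h => hne ⟨k, h⟩) _]
      linarith
  · by_contra! hcon
    -- Otherwise the weight of `x i` can be increased by the smallest slack.
    have : ∀ p : ι × ι, ∃ ε > 0, x i ∈ Metric.closedBall (x p.1) (R p) → m w p + ε ≤ R p := by
      intro p
      by_cases hp : x i ∈ Metric.closedBall (x p.1) (R p)
      · exact ⟨R p - m w p, sub_pos.2 (lt_of_le_of_ne (hK1 hwK p) (hcon p.1 _ (hR p) hp)),
          fun _ => by linarith⟩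
      · exact ⟨1, one_pos, fun h => absurd h hp⟩
    choose ε hε hεp using this
    have : Nonempty (ι × ι) := ⟨(i, i)⟩
    obtain ⟨p₀, -, hp₀⟩ := Finset.exists_min_image Finset.univ ε Finset.univ_nonempty
    let w' : ι → ℝ := fun k => w k + if k = i then ε p₀ else 0
    have hadd : ∀ k, w' k = w k + if k = i then ε p₀ else 0 := by
      exact fun k => rfl
    have hw' : w' ∈ K := by
      refine ⟨mem_iInter.2 fun k => ?_, mem_iInter.2 fun p => ?_⟩
      · rw [mem_ofPred_eq, hadd]
        have := hK0 hwK k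
        have := (hε p₀).le
        split_ifs <;> linarith
      · have : m w' p = m w p +
            (Metric.closedBall (x p.1) (R p)).indicator (fun _ => ε p₀) (x i) := by
          have h1 : (Metric.closedBall (x p.1) (R p)).indicator (fun _ => ε p₀) (x i) =
              ∑ k, if k = i then
                (Metric.closedBall (x p.1) (R p)).indicator (fun _ => ε p₀) (x k) else 0 := by
            simp
          rw [h1, ← Finset.sum_add_distrib]
          refine Finset.sum_congr rfl fun k _ => ?_
          rw [hadd]
          by_cases hk : x k ∈ Metric.closedBall (x p.1) (R p)
          · simp [hk]
          · simp [hk]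
        rw [mem_ofPred_eq, this]
        by_cases h : x i ∈ Metric.closedBall (x p.1) (R p)
        · rw [indicator_of_mem h]
          linarith [hεp p h, hp₀ p (Finset.mem_univ p)]
        · rw [indicator_of_notMem h, add_zero]
          exact hK1 hwK p
    have h1 : ∑ k, w' k ≤ ∑ k, w k := hwmax hw'
    simp only [hadd, Finset.sum_add_distrib, Finset.sum_ite_eq', Finset.mem_univ, if_true] at h1
    linarith [hε p₀]

/-- A discrete Frostman lemma: at every scale `δ`, a compact set carries a finitely supported
measure of linear growth at all scales at least `δ` whose mass controls the Hausdorff content.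
Vitali's covering lemma extracts disjoint balls from those with equality in the growth condition. -/
theorem exists_finite_frostman {n : ℕ} {E : Set (EuclideanSpace ℝ (Fin n))} (hE : IsCompact E)
    {δ : ℝ} (hδ : 0 < δ) :
    ∃ (ι : Type) (_ : Fintype ι) (x : ι → EuclideanSpace ℝ (Fin n)) (w : ι → ℝ),
      (∀ i, x i ∈ E) ∧ (∀ i, 0 ≤ w i) ∧
      (∀ z r, δ ≤ r → ∑ i, (Metric.closedBall z r).indicator (fun _ => w i) (x i) ≤ r) ∧
      hausdorffContentOne E ≤ ENNReal.ofReal (14 * ∑ i, w i) := by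
  classical
  obtain ⟨t, htE, htfin, htcov⟩ := hE.finite_cover_balls hδ
  have := htfin.fintype
  obtain ⟨w, hw0, hgrowth, htight⟩ :=
    exists_weights_tight (fun i : t => (i : EuclideanSpace ℝ (Fin n))) hδ
  choose c r hr hmem heq using htight
  refine ⟨t, inferInstance, fun i => i, fun i => w i / 2, fun i => htE i.2,
    fun i => div_nonneg (hw0 i) two_pos.le, fun z r hzr => ?_, ?_⟩
  · have h1 := hgrowth z r hzr
    have h2 : ∑ i : t, (Metric.closedBall z r).indicator (fun _ => w i / 2)
        (i : EuclideanSpace ℝ (Fin n)) = (∑ i : t, (Metric.closedBall z r).indicator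
        (fun _ => w i) (i : EuclideanSpace ℝ (Fin n))) / 2 := by
      rw [Finset.sum_div]
      refine Finset.sum_congr rfl fun i _ => ?_
      by_cases hi : (i : EuclideanSpace ℝ (Fin n)) ∈ Metric.closedBall z r <;> simp [hi]
    linarith
  obtain ⟨u, -, hudisj, hucov⟩ := Vitali.exists_disjoint_subfamily_covering_enlargement_closedBall
    univ (fun i => (c i : EuclideanSpace ℝ (Fin n))) r (∑ i, |r i|)
    (fun i _ => (le_abs_self _).trans
      (Finset.single_le_sum (f := fun i => |r i|) (fun _ _ => abs_nonneg _) (Finset.mem_univ i)))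
    5 (by norm_num)
  have hr0 : ∀ i, 0 ≤ r i := fun i => hδ.le.trans (hr i)
  have hcov : E ⊆ ⋃ i ∈ u.toFinset,
      Metric.ball (c i : EuclideanSpace ℝ (Fin n)) (7 * (r i).toNNReal : ℝ≥0) := by
    intro y hy
    obtain ⟨a, ha, hya⟩ := mem_iUnion₂.1 (htcov hy)
    obtain ⟨b, hb, hab⟩ := hucov ⟨a, ha⟩ (mem_univ _)
    refine mem_iUnion₂.2 ⟨b, by simpa using hb, ?_⟩
    have h1 := Metric.mem_closedBall.1 (hab (hmem ⟨a, ha⟩))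
    have h2 := Metric.mem_ball.1 hya
    have h3 := dist_triangle y a (c b)
    have h4 := hr b
    simp only [Metric.mem_ball, NNReal.coe_mul, NNReal.coe_ofNat, Real.coe_toNNReal _ (hr0 b)]
    dsimp only at h1
    linarith
  refine (hausdorffContentOne_le_sum _ _ _ _ hcov).trans ?_
  have h1 : ∑ b ∈ u.toFinset, r b ≤ ∑ i, w i := by
    have h2 : ∀ b, r b = ∑ i, (Metric.closedBall (c b : EuclideanSpace ℝ (Fin n)) (r b)).indicator
      (fun _ => w i) (i : EuclideanSpace ℝ (Fin n)) := fun b => (heq b).symm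
    rw [Finset.sum_congr rfl fun b _ => h2 b, Finset.sum_comm]
    refine Finset.sum_le_sum fun i _ => ?_
    -- The balls are disjoint, so at most one term of the sum does not vanish.
    by_cases hi : ∃ b ∈ u, (i : EuclideanSpace ℝ (Fin n)) ∈
        Metric.closedBall (c b : EuclideanSpace ℝ (Fin n)) (r b)
    · obtain ⟨b, hb, hib⟩ := hi
      rw [Finset.sum_eq_single_of_mem b (by simpa using hb), indicator_of_mem hib]
      intro b' hb' hne
      refine indicator_of_notMem (fun h => ?_) _
      exact Set.disjoint_left.1 (hudisj (by simpa using hb') hb hne) h hib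
    · rw [Finset.sum_eq_zero fun b hb =>
        indicator_of_notMem (fun h => hi ⟨b, by simpa using hb, h⟩) _]
      exact hw0 i
  calc ∑ b ∈ u.toFinset, ((7 * (r b).toNNReal : ℝ≥0) : ℝ≥0∞)
      = ENNReal.ofReal (7 * ∑ b ∈ u.toFinset, r b) := by
        rw [Finset.mul_sum, ENNReal.ofReal_sum_of_nonneg (fun b _ => by have := hr0 b; positivity)]
        refine Finset.sum_congr rfl fun b _ => ?_
        rw [ENNReal.ofReal_mul (by norm_num), ENNReal.coe_mul]
        simp [ENNReal.ofReal]
    _ ≤ _ := ENNReal.ofReal_le_ofReal (by rw [← Finset.sum_div]; linarith)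

/-! ### Smooth averages of Sobolev functions over balls -/

/-- A smooth probability density supported in the closed unit ball. -/
structure IsAveragingKernel {n : ℕ} (φ : EuclideanSpace ℝ (Fin n) → ℝ) : Prop where
  contDiff : ContDiff ℝ ∞ φ
  tsupport_subset : tsupport φ ⊆ Metric.closedBall 0 1
  nonneg : ∀ y, 0 ≤ φ y
  integral_eq_one : ∫ y, φ y = 1

theorem exists_isAveragingKernel (n : ℕ) :
    ∃ φ : EuclideanSpace ℝ (Fin n) → ℝ, IsAveragingKernel φ := by
  let f : ContDiffBump (0 : EuclideanSpace ℝ (Fin n)) := ⟨1 / 2, 1, by norm_num, by norm_num⟩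
  exact ⟨f.normed volume, f.contDiff_normed, f.tsupport_normed_eq.subset, f.nonneg_normed,
    f.integral_normed⟩

/-- The smooth average of `u` over the ball of center `p` and radius `r`, with density the rescaled
kernel `φ`. -/
noncomputable def smoothAverage {n : ℕ} (Ω : Set (EuclideanSpace ℝ (Fin n)))
    (φ u : EuclideanSpace ℝ (Fin n) → ℝ) (p : EuclideanSpace ℝ (Fin n)) (r : ℝ) : ℝ :=
  ∫ z in Ω, u z * ((r ^ n)⁻¹ * φ (r⁻¹ • (z - p)))

section Kernel

variable {n : ℕ} {ψ : EuclideanSpace ℝ (Fin n) → ℝ}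

theorem hasCompactSupport_of_tsupport_subset (hsupp : tsupport ψ ⊆ Metric.closedBall 0 1) :
    HasCompactSupport ψ :=
  (isCompact_closedBall 0 1).of_isClosed_subset (isClosed_tsupport ψ) hsupp

theorem eq_zero_of_one_lt_norm (hsupp : tsupport ψ ⊆ Metric.closedBall 0 1)
    {y : EuclideanSpace ℝ (Fin n)} (hy : 1 < ‖y‖) : ψ y = 0 := by
  refine image_eq_zero_of_notMem_tsupport fun h => ?_
  have := hsupp h
  rw [mem_closedBall_zero_iff] at this
  linarith

theorem norm_rescale_le_iff {r : ℝ} (hr : 0 < r) (z p : EuclideanSpace ℝ (Fin n)) :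
    ‖r⁻¹ • (z - p)‖ ≤ 1 ↔ z ∈ Metric.closedBall p r := by
  rw [norm_smul, norm_inv, Real.norm_of_nonneg hr.le, inv_mul_le_iff₀ hr, mul_one,
    Metric.mem_closedBall, dist_eq_norm]

theorem rescale_eq_zero (hsupp : tsupport ψ ⊆ Metric.closedBall 0 1) {r : ℝ} (hr : 0 < r)
    {z p : EuclideanSpace ℝ (Fin n)} (hz : z ∉ Metric.closedBall p r) :
    ψ (r⁻¹ • (z - p)) = 0 := by
  refine eq_zero_of_one_lt_norm hsupp ?_
  rw [← norm_rescale_le_iff hr] at hz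
  exact not_le.1 hz

end Kernel

section Average

variable {n : ℕ} {Ω : Set (EuclideanSpace ℝ (Fin n))} {φ ψ u : EuclideanSpace ℝ (Fin n) → ℝ}
  {g : EuclideanSpace ℝ (Fin n) → EuclideanSpace ℝ (Fin n)}

theorem IsSobolevWithGradient.integral_mul_fderiv_rescale (h : IsSobolevWithGradient Ω u g)
    (hψ : ContDiff ℝ ∞ ψ) (hsupp : tsupport ψ ⊆ Metric.closedBall 0 1) {r : ℝ} (hr : 0 < r)
    {p : EuclideanSpace ℝ (Fin n)} (hball : Metric.closedBall p r ⊆ Ω)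
    (w : EuclideanSpace ℝ (Fin n)) :
    ∫ z in Ω, u z * fderiv ℝ ψ (r⁻¹ • (z - p)) w
      = -r * ∫ z in Ω, inner ℝ (g z) w * ψ (r⁻¹ • (z - p)) := by
  have hts : tsupport (fun z => ψ (r⁻¹ • (z - p))) ⊆ Metric.closedBall p r := by
    refine closure_minimal (fun z hz => ?_) Metric.isClosed_closedBall
    by_contra hcon
    exact hz (rescale_eq_zero hsupp hr hcon)
  have key := h.weak_gradient (fun z => ψ (r⁻¹ • (z - p)))
    (hψ.comp ((contDiff_id.sub contDiff_const).const_smul _))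
    ((isCompact_closedBall p r).of_isClosed_subset (isClosed_tsupport _) hts)
    (hts.trans hball) w
  have hd : ∀ z, fderiv ℝ (fun z => ψ (r⁻¹ • (z - p))) z w
      = r⁻¹ * fderiv ℝ ψ (r⁻¹ • (z - p)) w := by
    intro z
    have h1 : HasFDerivAt (fun z => r⁻¹ • (z - p))
        (r⁻¹ • ContinuousLinearMap.id ℝ (EuclideanSpace ℝ (Fin n))) z :=
      ((hasFDerivAt_id z).sub_const p).const_smul r⁻¹
    have h2 := ((hψ.differentiable (by simp)).differentiableAt
      (x := r⁻¹ • (z - p))).hasFDerivAt.comp z h1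
    rw [HasFDerivAt.fderiv (f := fun z => ψ (r⁻¹ • (z - p))) h2]
    simp
  simp_rw [hd] at key
  rw [show -r * ∫ z in Ω, inner ℝ (g z) w * ψ (r⁻¹ • (z - p))
      = r * -∫ z in Ω, inner ℝ (g z) w * ψ (r⁻¹ • (z - p)) by ring, ← key, ← integral_const_mul]
  refine integral_congr_ae (Filter.Eventually.of_forall fun z => ?_)
  field_simp

theorem integrableOn_mul_rescale {f : EuclideanSpace ℝ (Fin n) → ℝ} (hf : IntegrableOn f Ω)
    {η : EuclideanSpace ℝ (Fin n) → ℝ} (hη : Continuous η) (hη' : HasCompactSupport η)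
    (r : ℝ) (p : EuclideanSpace ℝ (Fin n)) :
    IntegrableOn (fun z => f z * η (r⁻¹ • (z - p))) Ω := by
  obtain ⟨K, hK⟩ := hη'.exists_bound_of_continuous hη
  exact Integrable.mul_bdd (c := K) hf
    ((hη.comp (by fun_prop : Continuous fun z => r⁻¹ • (z - p))).aestronglyMeasurable)
    (Filter.Eventually.of_forall fun z => hK _)

/-- The weak gradient tested against the vector field `φ(y) (v + s y)`, `y = (z - p) / r`, which
generates the translations and dilations of the kernel. -/
theorem IsSobolevWithGradient.integral_mul_divergence (h : IsSobolevWithGradient Ω u g)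
    (hu : IntegrableOn u Ω) (hg : IntegrableOn g Ω) (hφ : ContDiff ℝ ∞ φ)
    (hsupp : tsupport φ ⊆ Metric.closedBall 0 1) {r : ℝ} (hr : 0 < r)
    {p : EuclideanSpace ℝ (Fin n)} (hball : Metric.closedBall p r ⊆ Ω)
    (v : EuclideanSpace ℝ (Fin n)) (s : ℝ) :
    ∫ z in Ω, u z * (n * s * φ (r⁻¹ • (z - p))
        + fderiv ℝ φ (r⁻¹ • (z - p)) (v + s • (r⁻¹ • (z - p))))
      = -r * ∫ z in Ω, inner ℝ (g z) (v + s • (r⁻¹ • (z - p))) * φ (r⁻¹ • (z - p)) := by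
  let b := EuclideanSpace.basisFun (Fin n) ℝ
  let ψ : Fin n → EuclideanSpace ℝ (Fin n) → ℝ := fun i y => φ y * inner ℝ (b i) y
  have hψ : ∀ i, ContDiff ℝ ∞ (ψ i) := fun i => hφ.mul (contDiff_const.inner ℝ contDiff_id)
  have hψs : ∀ i, tsupport (ψ i) ⊆ Metric.closedBall 0 1 := fun i =>
    (tsupport_mul_subset_left).trans hsupp
  have hgw : ∀ w, IntegrableOn (fun z => inner ℝ (g z) w) Ω := fun w => hg.inner_const w
  have hdψ : ∀ i y, fderiv ℝ (ψ i) y (b i)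
      = fderiv ℝ φ y (b i) * inner ℝ (b i) y + φ y := by
    intro i y
    have h1 := ((hφ.differentiable (by simp)).differentiableAt (x := y)).hasFDerivAt
    have h2 : HasFDerivAt (fun y => inner ℝ (b i) y) (innerSL ℝ (b i)) y :=
      (innerSL ℝ (b i)).hasFDerivAt
    rw [HasFDerivAt.fderiv (f := ψ i) (h1.mul h2)]
    simp only [add_apply, smul_apply, innerSL_apply_apply,
      smul_eq_mul, b.inner_eq_one]
    ring
  have hsum : ∀ y : EuclideanSpace ℝ (Fin n), ∑ i, (inner ℝ (b i) y : ℝ) • b i = y :=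
    b.sum_repr'
  have hL : ∀ y, (n * s * φ y + fderiv ℝ φ y (v + s • y))
      = fderiv ℝ φ y v + ∑ i, s * fderiv ℝ (ψ i) y (b i) := by
    intro y
    have h1 : fderiv ℝ φ y y = ∑ i, (inner ℝ (b i) y : ℝ) * fderiv ℝ φ y (b i) := by
      calc fderiv ℝ φ y y = fderiv ℝ φ y (∑ i, (inner ℝ (b i) y : ℝ) • b i) := by rw [hsum y]
        _ = _ := by simp only [map_sum, map_smul, smul_eq_mul]
    simp only [hdψ, ← Finset.mul_sum, Finset.sum_add_distrib, map_add, map_smul, smul_eq_mul, h1,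
      Finset.sum_const, Finset.card_univ, Fintype.card_fin, nsmul_eq_mul,
      mul_comm (inner ℝ _ y : ℝ)]
    ring
  have hR : ∀ a y : EuclideanSpace ℝ (Fin n), inner ℝ a (v + s • y) * φ y
      = inner ℝ a v * φ y + ∑ i, s * (inner ℝ a (b i) * ψ i y) := by
    intro a y
    have h1 : inner ℝ a y = ∑ i, (inner ℝ (b i) y : ℝ) * inner ℝ a (b i) := by
      conv_lhs => rw [← hsum y]
      rw [inner_sum]
      simp [inner_smul_right]
    rw [inner_add_right, inner_smul_right, h1, add_mul, mul_assoc, Finset.sum_mul, Finset.mul_sum]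
    congr 1
    refine Finset.sum_congr rfl fun i _ => ?_
    simp only [ψ]; ring
  have hint1 : ∀ {η : EuclideanSpace ℝ (Fin n) → ℝ}, ContDiff ℝ ∞ η →
      tsupport η ⊆ Metric.closedBall 0 1 → ∀ w,
      IntegrableOn (fun z => u z * fderiv ℝ η (r⁻¹ • (z - p)) w) Ω := fun hη hηs w =>
    integrableOn_mul_rescale hu (η := fun y => fderiv ℝ _ y w)
      ((hη.continuous_fderiv (by simp)).clm_apply continuous_const)
      ((hasCompactSupport_of_tsupport_subset hηs).fderiv_apply ℝ w) r p
  have hint2 : ∀ {η : EuclideanSpace ℝ (Fin n) → ℝ}, ContDiff ℝ ∞ η →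
      tsupport η ⊆ Metric.closedBall 0 1 → ∀ w,
      IntegrableOn (fun z => inner ℝ (g z) w * η (r⁻¹ • (z - p))) Ω := fun hη hηs w =>
    integrableOn_mul_rescale (hgw w) hη.continuous (hasCompactSupport_of_tsupport_subset hηs) r p
  simp_rw [hL, hR, mul_add, Finset.mul_sum]
  rw [integral_add (hint1 hφ hsupp v), integral_add (hint2 hφ hsupp v),
    integral_finsetSum, integral_finsetSum, h.integral_mul_fderiv_rescale hφ hsupp hr hball v,
    mul_add, Finset.mul_sum]
  · congr 1
    refine Finset.sum_congr rfl fun i _ => ?_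
    have h1 := h.integral_mul_fderiv_rescale (hψ i) (hψs i) hr hball (b i)
    simp_rw [mul_left_comm _ s]
    rw [integral_const_mul, integral_const_mul, h1]
    ring
  · exact fun i _ => (hint2 (hψ i) (hψs i) (b i)).const_mul s
  · intro i _
    simp_rw [mul_left_comm _ s]
    exact (hint1 (hψ i) (hψs i) (b i)).const_mul s
  · exact integrable_finsetSum _ fun i _ => (hint2 (hψ i) (hψs i) (b i)).const_mul s
  · refine integrable_finsetSum _ fun i _ => ?_
    simp_rw [mul_left_comm _ s]
    exact (hint1 (hψ i) (hψs i) (b i)).const_mul s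

theorem hasDerivAt_inv_pow_affine (n : ℕ) (r s t : ℝ) (h : r + t * s ≠ 0) :
    HasDerivAt (fun t => ((r + t * s) ^ n)⁻¹) (-(n * s) * ((r + t * s) ^ (n + 1))⁻¹) t := by
  have h1 : HasDerivAt (fun t => r + t * s) s t := by
    simpa using ((hasDerivAt_id t).mul_const s).const_add r
  cases n with
  | zero => simpa using hasDerivAt_const t (1 : ℝ)
  | succ k =>
    refine ((h1.fun_pow (k + 1)).fun_inv (pow_ne_zero _ h)).congr_deriv ?_
    rw [Nat.add_sub_cancel]
    field_simp
    ring

theorem hasDerivAt_rescaled_kernel (hφ : Differentiable ℝ φ) (z p v : EuclideanSpace ℝ (Fin n))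
    (r s t : ℝ) (h : r + t * s ≠ 0) :
    HasDerivAt (fun t : ℝ => ((r + t * s) ^ n)⁻¹ * φ ((r + t * s)⁻¹ • (z - (p + t • v))))
      (-((r + t * s) ^ (n + 1))⁻¹ * (n * s * φ ((r + t * s)⁻¹ • (z - (p + t • v)))
        + fderiv ℝ φ ((r + t * s)⁻¹ • (z - (p + t • v)))
          (v + s • ((r + t * s)⁻¹ • (z - (p + t • v)))))) t := by
  have h0 : HasDerivAt (fun t => r + t * s) s t := by
    simpa using ((hasDerivAt_id t).mul_const s).const_add r
  have h1 : HasDerivAt (fun t : ℝ => z - (p + t • v)) (-v) t := by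
    simpa using (((hasDerivAt_id t).smul_const v).const_add p).const_sub z
  have h2 : HasDerivAt (fun t : ℝ => (r + t * s)⁻¹ • (z - (p + t • v)))
      (-(r + t * s)⁻¹ • (v + s • ((r + t * s)⁻¹ • (z - (p + t • v))))) t := by
    refine ((h0.fun_inv h).fun_smul h1).congr_deriv ?_
    rw [smul_add, smul_neg, neg_smul, neg_smul, smul_smul, smul_smul, neg_div, neg_smul]
    congr 3
    field_simp
  have h3 := (hφ ((r + t * s)⁻¹ • (z - (p + t • v)))).hasFDerivAt.comp_hasDerivAt t h2
  refine ((hasDerivAt_inv_pow_affine n r s t h).fun_mul h3).congr_deriv ?_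
  rw [map_smul, smul_eq_mul, Function.comp_apply]
  field_simp
  ring

/-- The average of a Sobolev function over a ball changes, when the ball is moved through a set `B`,
by at most the length of the motion times the integral of the gradient over `B`. -/
theorem IsSobolevWithGradient.abs_smoothAverage_sub_le (h : IsSobolevWithGradient Ω u g)
    (hu : IntegrableOn u Ω) (hg : IntegrableOn g Ω) (hφ : IsAveragingKernel φ)
    {K : ℝ} (hK : ∀ y, φ y ≤ K) {ρ : ℝ} (hρ : 0 < ρ) {p v : EuclideanSpace ℝ (Fin n)} {r s : ℝ}
    {B : Set (EuclideanSpace ℝ (Fin n))} (hB : MeasurableSet B) (hBΩ : B ⊆ Ω)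
    (hr : ∀ t ∈ Icc (0 : ℝ) 1, ρ ≤ r + t * s)
    (hball : ∀ t ∈ Icc (0 : ℝ) 1, Metric.closedBall (p + t • v) (r + t * s) ⊆ B) :
    |smoothAverage Ω φ u (p + v) (r + s) - smoothAverage Ω φ u p r|
      ≤ K * (‖v‖ + |s|) * (ρ ^ n)⁻¹ * ∫ z in B, ‖g z‖ := by
  have hK0 : 0 ≤ K := (hφ.nonneg 0).trans (hK 0)
  have hcs := hasCompactSupport_of_tsupport_subset hφ.tsupport_subset
  have hdiff : Differentiable ℝ φ := hφ.contDiff.differentiable (by simp)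
  let Θ : EuclideanSpace ℝ (Fin n) → ℝ := fun y => n * s * φ y + fderiv ℝ φ y (v + s • y)
  have hΘc : Continuous Θ :=
    (continuous_const.mul hφ.contDiff.continuous).add
      ((hφ.contDiff.continuous_fderiv (by simp)).clm_apply (by fun_prop))
  have hΘs : HasCompactSupport Θ := by
    refine hcs.mono' fun y hy => ?_
    by_contra hcon
    refine hy ?_
    have h1 : φ y = 0 := image_eq_zero_of_notMem_tsupport hcon
    have h2 : fderiv ℝ φ y = 0 :=
      image_eq_zero_of_notMem_tsupport fun h => hcon (tsupport_fderiv_subset ℝ h)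
    simp [Θ, h1, h2]
  obtain ⟨C, hC⟩ := hΘs.exists_bound_of_continuous hΘc
  have hderiv : ∀ t ∈ Icc (0 : ℝ) 1,
      HasDerivAt (fun t : ℝ => smoothAverage Ω φ u (p + t • v) (r + t * s))
        (∫ z in Ω, u z * (-((r + t * s) ^ (n + 1))⁻¹ *
          Θ ((r + t * s)⁻¹ • (z - (p + t • v))))) t := by
    intro t ht
    have hrt := hr t ht
    have hU : {t : ℝ | ρ / 2 < r + t * s} ∈ nhds t :=
      (isOpen_lt continuous_const (by fun_prop)).mem_nhds
        (show ρ / 2 < r + t * s by linarith)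
    refine (hasDerivAt_integral_of_dominated_loc_of_deriv_le
      (F := fun t z => u z * (((r + t * s) ^ n)⁻¹ * φ ((r + t * s)⁻¹ • (z - (p + t • v)))))
      (F' := fun t z => u z * (-((r + t * s) ^ (n + 1))⁻¹ *
        Θ ((r + t * s)⁻¹ • (z - (p + t • v)))))
      (bound := fun z => |u z| * (((ρ / 2) ^ (n + 1))⁻¹ * C)) hU ?_ ?_ ?_ ?_ ?_ ?_).2
    · refine Filter.Eventually.of_forall fun t => hu.aestronglyMeasurable.mul ?_
      exact (continuous_const.mul (hφ.contDiff.continuous.comp (by fun_prop))).aestronglyMeasurable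
    · simp_rw [mul_left_comm (u _)]
      exact (integrableOn_mul_rescale hu hφ.contDiff.continuous hcs _ _).const_mul _
    · refine hu.aestronglyMeasurable.mul ?_
      exact (continuous_const.mul (hΘc.comp (by fun_prop))).aestronglyMeasurable
    · refine Filter.Eventually.of_forall fun z t ht => ?_
      have ht' : ρ / 2 < r + t * s := ht
      rw [norm_mul, norm_mul, norm_neg, Real.norm_eq_abs (u z), norm_inv,
        Real.norm_of_nonneg (pow_nonneg (by linarith) _)]
      have := hC ((r + t * s)⁻¹ • (z - (p + t • v)))
      gcongr
    · exact hu.abs.mul_const _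
    · refine Filter.Eventually.of_forall fun z t ht => ?_
      have ht' : ρ / 2 < r + t * s := ht
      exact (hasDerivAt_rescaled_kernel hdiff z p v r s t (by linarith)).const_mul (u z)
  have hbound : ∀ t ∈ Icc (0 : ℝ) 1,
      ‖∫ z in Ω, u z * (-((r + t * s) ^ (n + 1))⁻¹ * Θ ((r + t * s)⁻¹ • (z - (p + t • v))))‖
        ≤ K * (‖v‖ + |s|) * (ρ ^ n)⁻¹ * ∫ z in B, ‖g z‖ := by
    intro t ht
    have hrt := hr t ht
    have hr0 : 0 < r + t * s := hρ.trans_le hrt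
    simp_rw [mul_left_comm (u _)]
    rw [integral_const_mul, h.integral_mul_divergence hu hg hφ.contDiff hφ.tsupport_subset hr0
      ((hball t ht).trans hBΩ) v s]
    have h1 : ‖∫ z in Ω, inner ℝ (g z) (v + s • ((r + t * s)⁻¹ • (z - (p + t • v)))) *
        φ ((r + t * s)⁻¹ • (z - (p + t • v)))‖ ≤ K * (‖v‖ + |s|) * ∫ z in B, ‖g z‖ := by
      have h2 : IntegrableOn (fun z => K * (‖v‖ + |s|) * ‖g z‖) Ω := hg.norm.const_mul _
      refine (norm_integral_le_of_norm_le (h2.indicator hB)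
        (Filter.Eventually.of_forall fun z => ?_)).trans (le_of_eq ?_)
      · by_cases hz : z ∈ Metric.closedBall (p + t • v) (r + t * s)
        · rw [indicator_of_mem (hball t ht hz), norm_mul, Real.norm_of_nonneg (hφ.nonneg _)]
          have hy := (norm_rescale_le_iff hr0 z (p + t • v)).2 hz
          have h3 : ‖v + s • ((r + t * s)⁻¹ • (z - (p + t • v)))‖ ≤ ‖v‖ + |s| := by
            refine (norm_add_le _ _).trans ?_
            rw [norm_smul s, Real.norm_eq_abs]
            gcongr
            exact mul_le_of_le_one_right (abs_nonneg s) hy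
          calc _ ≤ ‖g z‖ * (‖v‖ + |s|) * K := by
                refine mul_le_mul ((norm_inner_le_norm _ _).trans ?_) (hK _) (hφ.nonneg _)
                  (by positivity)
                gcongr
            _ = _ := by ring
        · rw [rescale_eq_zero hφ.tsupport_subset hr0 hz, mul_zero, norm_zero]
          exact indicator_nonneg (fun z _ => by positivity) z
      · rw [setIntegral_indicator hB, inter_eq_right.2 hBΩ, integral_const_mul]
    rw [norm_mul, norm_mul, norm_neg, norm_neg, norm_inv, norm_pow, Real.norm_of_nonneg hr0.le,
      pow_succ, mul_inv, mul_assoc, inv_mul_cancel_left₀ hr0.ne']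
    calc _ ≤ (ρ ^ n)⁻¹ * (K * (‖v‖ + |s|) * ∫ z in B, ‖g z‖) := by gcongr
      _ = _ := by ring
  have := norm_image_sub_le_of_norm_deriv_le_segment_01'
    (fun t ht => (hderiv t ht).hasDerivWithinAt) (fun t ht => hbound t (Ico_subset_Icc_self ht))
  simpa using this

theorem integral_rescaled_kernel (hφ : IsAveragingKernel φ) {r : ℝ} (hr : 0 < r)
    {p : EuclideanSpace ℝ (Fin n)} (hball : Metric.closedBall p r ⊆ Ω) :
    ∫ z in Ω, (r ^ n)⁻¹ * φ (r⁻¹ • (z - p)) = 1 := by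
  rw [setIntegral_eq_integral_of_forall_compl_eq_zero fun z hz => by
      rw [rescale_eq_zero hφ.tsupport_subset hr fun h => hz (hball h), mul_zero],
    integral_const_mul, integral_sub_right_eq_self (fun z => φ (r⁻¹ • z)) p,
    Measure.integral_comp_inv_smul_of_nonneg volume _ hr.le, hφ.integral_eq_one]
  simp only [finrank_euclideanSpace, Fintype.card_fin, smul_eq_mul, mul_one]
  exact inv_mul_cancel₀ (pow_ne_zero _ hr.ne')

theorem smoothAverage_mono (hu : IntegrableOn u Ω) {w : EuclideanSpace ℝ (Fin n) → ℝ}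
    (hw : IntegrableOn w Ω) (hφ : IsAveragingKernel φ) {r : ℝ} (hr : 0 < r)
    {p : EuclideanSpace ℝ (Fin n)} (hle : ∀ z ∈ Metric.closedBall p r, u z ≤ w z) :
    smoothAverage Ω φ u p r ≤ smoothAverage Ω φ w p r := by
  have hcs := hasCompactSupport_of_tsupport_subset hφ.tsupport_subset
  have hint : ∀ {f : EuclideanSpace ℝ (Fin n) → ℝ}, IntegrableOn f Ω →
      IntegrableOn (fun z => f z * ((r ^ n)⁻¹ * φ (r⁻¹ • (z - p)))) Ω := by
    intro f hf
    simp_rw [mul_left_comm (f _)]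
    exact (integrableOn_mul_rescale hf hφ.contDiff.continuous hcs _ _).const_mul _
  refine integral_mono (hint hu) (hint hw) fun z => ?_
  by_cases hz : z ∈ Metric.closedBall p r
  · exact mul_le_mul_of_nonneg_right (hle z hz)
      (mul_nonneg (inv_nonneg.2 (pow_nonneg hr.le _)) (hφ.nonneg _))
  · simp only [rescale_eq_zero hφ.tsupport_subset hr hz, mul_zero, le_refl]

theorem smoothAverage_const (hφ : IsAveragingKernel φ) {r : ℝ} (hr : 0 < r)
    {p : EuclideanSpace ℝ (Fin n)} (hball : Metric.closedBall p r ⊆ Ω) (c : ℝ) :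
    smoothAverage Ω φ (fun _ => c) p r = c := by
  unfold smoothAverage
  rw [integral_const_mul, integral_rescaled_kernel hφ hr hball, mul_one]

end Average

/-! ### John curves ending at the centre of the central cube -/

section Cube

variable {n : ℕ} {Ω : Set (EuclideanSpace ℝ (Fin n))} {W : Set (AxisCube n)} {Q : AxisCube n}

theorem AxisCube.mem_carrier {Q : AxisCube n} {z : EuclideanSpace ℝ (Fin n)} :
    z ∈ Q.carrier ↔ ∀ i, |z i - Q.center i| ≤ Q.halfSide := by
  simp [AxisCube.carrier, AxisCube.dilate]

theorem AxisCube.center_mem (Q : AxisCube n) : Q.center ∈ Q.carrier :=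
  AxisCube.mem_carrier.2 fun i => by simpa using Q.halfSide_pos.le

theorem AxisCube.closedBall_subset (Q : AxisCube n) :
    Metric.closedBall Q.center Q.halfSide ⊆ Q.carrier := by
  intro z hz
  refine AxisCube.mem_carrier.2 fun i => ?_
  have h1 := PiLp.norm_apply_le (z - Q.center) i
  rw [Metric.mem_closedBall, dist_eq_norm] at hz
  simpa using h1.trans hz

theorem AxisCube.add_smul_mem (Q : AxisCube n) {z : EuclideanSpace ℝ (Fin n)}
    (hz : z ∈ Q.carrier) {t : ℝ} (ht : t ∈ Icc (0 : ℝ) 1) :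
    z + t • (Q.center - z) ∈ Q.carrier := by
  refine AxisCube.mem_carrier.2 fun i => ?_
  have h1 := AxisCube.mem_carrier.1 hz i
  have : (z + t • (Q.center - z)) i - Q.center i = (1 - t) * (z i - Q.center i) := by
    simp only [PiLp.add_apply, PiLp.smul_apply, PiLp.sub_apply, smul_eq_mul]; ring
  rw [this, abs_mul, abs_of_nonneg (by linarith [ht.2] : 0 ≤ 1 - t)]
  exact (mul_le_of_le_one_left (abs_nonneg _) (by linarith [ht.1])).trans h1

theorem AxisCube.dist_le (Q : AxisCube n) {y z : EuclideanSpace ℝ (Fin n)}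
    (hy : y ∈ Q.carrier) (hz : z ∈ Q.carrier) : dist y z ≤ 2 * Q.halfSide * n := by
  have h0 := Q.halfSide_pos
  have h1 : ∀ i, dist (y i) (z i) ≤ 2 * Q.halfSide := by
    intro i
    have hy := abs_le.1 (AxisCube.mem_carrier.1 hy i)
    have hz := abs_le.1 (AxisCube.mem_carrier.1 hz i)
    rw [Real.dist_eq, abs_le]
    constructor <;> linarith [hy.1, hy.2, hz.1, hz.2]
  rw [EuclideanSpace.dist_eq]
  refine Real.sqrt_le_iff.2 ⟨by positivity, ?_⟩
  calc ∑ i, dist (y i) (z i) ^ 2 ≤ ∑ _i : Fin n, (2 * Q.halfSide) ^ 2 :=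
        Finset.sum_le_sum fun i _ => pow_le_pow_left₀ dist_nonneg (h1 i) 2
    _ = (2 * Q.halfSide) ^ 2 * n := by simp [mul_comm]
    _ ≤ (2 * Q.halfSide) ^ 2 * (n : ℝ) ^ 2 := by
        gcongr
        exact_mod_cast Nat.le_self_pow two_ne_zero n
    _ = _ := by ring

theorem IsWhitneyDecomposition.carrier_subset (hW : IsWhitneyDecomposition Ω W) (hQ : Q ∈ W) :
    Q.carrier ⊆ Ω := by
  rw [← hW.iUnion_eq]
  exact subset_biUnion_of_mem (u := fun Q : AxisCube n => Q.carrier) hQ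

theorem IsWhitneyDecomposition.two_mul_halfSide_le_infDist (hn : 0 < n)
    (hW : IsWhitneyDecomposition Ω W) (hQ : Q ∈ W) (hF : (frontier Ω).Nonempty)
    {z : EuclideanSpace ℝ (Fin n)} (hz : z ∈ Q.carrier) :
    2 * Q.halfSide ≤ Metric.infDist z (frontier Ω) := by
  have h0 := Q.halfSide_pos
  let e : EuclideanSpace ℝ (Fin n) := EuclideanSpace.single ⟨0, hn⟩ Q.halfSide
  have he : ‖e‖ = Q.halfSide := by simp [e, abs_of_pos h0]
  have h1 : Q.center + e ∈ Q.carrier := Q.closedBall_subset (by simp [he])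
  have h2 : Q.center - e ∈ Q.carrier :=
    Q.closedBall_subset (by simp [Metric.mem_closedBall, he])
  have h3 : edist (Q.center + e) (Q.center - e) ≤ Metric.infEDist z (frontier Ω) :=
    (Metric.edist_le_ediam_of_mem h1 h2).trans ((hW.diam_le_dist Q hQ).trans (iInf₂_le z hz))
  have h4 : dist (Q.center + e) (Q.center - e) = 2 * Q.halfSide := by
    rw [dist_eq_norm, show Q.center + e - (Q.center - e) = (2 : ℝ) • e by rw [two_smul]; abel,
      norm_smul, he]
    norm_num
  rw [← h4, Metric.infDist, dist_edist]
  exact ENNReal.toReal_mono (Metric.infEDist_ne_top hF) h3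

theorem IsWhitneyDecomposition.infDist_le (hn : 0 < n)
    (hW : IsWhitneyDecomposition Ω W) (hQ : Q ∈ W)
    {z : EuclideanSpace ℝ (Fin n)} (hz : z ∈ Q.carrier) :
    Metric.infDist z (frontier Ω) ≤ 11 * Q.halfSide * n := by
  have h0 := Q.halfSide_pos
  have hn' : (0 : ℝ) < n := by exact_mod_cast hn
  have hd : Metric.ediam Q.carrier ≤ ENNReal.ofReal (2 * Q.halfSide * n) :=
    Metric.ediam_le fun x hx y hy => by
      rw [edist_dist]; exact ENNReal.ofReal_le_ofReal (Q.dist_le hx hy)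
  have h1 : setDist Q.carrier (frontier Ω) < ENNReal.ofReal (9 * Q.halfSide * n) := by
    refine (hW.dist_le_diam Q hQ).trans_lt ((mul_le_mul_right hd 4).trans_lt ?_)
    rw [show (4 : ℝ≥0∞) = ENNReal.ofReal 4 by simp, ← ENNReal.ofReal_mul (by norm_num),
      ENNReal.ofReal_lt_ofReal_iff (by positivity)]
    have : 0 < Q.halfSide * n := by positivity
    linarith
  unfold setDist at h1
  obtain ⟨y, hy⟩ := iInf_lt_iff.1 h1
  obtain ⟨hyQ, hy⟩ := iInf_lt_iff.1 hy
  have h2 : Metric.infDist y (frontier Ω) ≤ 9 * Q.halfSide * n :=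
    ENNReal.toReal_le_of_le_ofReal (by positivity) hy.le
  have h3 := Metric.infDist_le_infDist_add_dist (s := frontier Ω) (x := z) (y := y)
  have h4 := Q.dist_le hz hyQ
  linarith

end Cube

/-- John curves, prolonged by a segment from the John centre to the centre of the central cube `Q`.
The constant is chosen so large that the ball of radius `l / (4 c)` about the endpoint lies
in `Q`. -/
theorem IsJohnDomain.exists_curve_to_cube {n : ℕ} (hn : 0 < n) {c₀ : ℝ} (hc₀ : 0 < c₀)
    {Ω : Set (EuclideanSpace ℝ (Fin n))} {x₀ : EuclideanSpace ℝ (Fin n)} {W : Set (AxisCube n)}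
    {Q : AxisCube n} (hΩ : IsJohnDomain c₀ Ω x₀) (hW : IsWhitneyDecomposition Ω W) (hQ : Q ∈ W)
    (hx₀ : x₀ ∈ Q.carrier) (hF : (frontier Ω).Nonempty) {x : EuclideanSpace ℝ (Fin n)}
    (hx : x ∈ Ω) :
    ∃ (l : ℝ) (γ : ℝ → EuclideanSpace ℝ (Fin n)), 0 ≤ l ∧ γ 0 = x ∧ γ l = Q.center ∧
      (∀ s ∈ Icc 0 l, ∀ t ∈ Icc 0 l, dist (γ s) (γ t) ≤ |t - s|) ∧
      (∀ t ∈ Icc 0 l, γ t ∈ Ω ∧ t / (n * (11 * c₀ + 2)) ≤ Metric.infDist (γ t) (frontier Ω)) ∧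
      l / (n * (11 * c₀ + 2)) ≤ Q.halfSide := by
  obtain ⟨l, γ, hγ⟩ := hΩ.exists_curve x hx
  have h0 := Q.halfSide_pos
  have hn1 : (1 : ℝ) ≤ n := by exact_mod_cast hn
  have hl := hγ.length_nonneg
  have hc : 0 < n * (11 * c₀ + 2) := by positivity
  have hcc : c₀ ≤ n * (11 * c₀ + 2) := by nlinarith
  set q := Q.center with hq
  set σ := dist x₀ q with hσ
  have hσ0 : 0 ≤ σ := dist_nonneg
  have hσ1 : σ ≤ 2 * Q.halfSide * n := Q.dist_le hx₀ Q.center_mem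
  have hl1 : l ≤ c₀ * (11 * Q.halfSide * n) := by
    have h1 := hγ.john l ⟨hl, le_rfl⟩
    rw [hγ.finish] at h1
    have h2 := h1.trans (hW.infDist_le hn hQ hx₀)
    rwa [div_le_iff₀' hc₀] at h2
  have hlσ : (l + σ) / (n * (11 * c₀ + 2)) ≤ Q.halfSide := by
    rw [div_le_iff₀ hc]
    calc l + σ ≤ c₀ * (11 * Q.halfSide * n) + 2 * Q.halfSide * n := add_le_add hl1 hσ1
      _ = _ := by ring
  have hLip : ∀ s ∈ Icc 0 l, ∀ t ∈ Icc 0 l, s ≤ t → dist (γ s) (γ t) ≤ t - s := by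
    intro s hs t ht hst
    have h1 := eVariationOn.edist_le γ (s := Icc 0 l ∩ Icc s t) ⟨hs, le_rfl, hst⟩ ⟨ht, hst, le_rfl⟩
    have h2 := hγ.arcLength hs ht
    rw [h2, edist_dist] at h1
    simpa using (ENNReal.ofReal_le_ofReal_iff (by simpa using hst)).1 h1
  let η : ℝ → EuclideanSpace ℝ (Fin n) := fun t => x₀ + ((t - l) / σ) • (q - x₀)
  have hη : ∀ s t, dist (η s) (η t) ≤ |t - s| := by
    intro s t
    have h1 : η s - η t = ((s - t) / σ) • (q - x₀) := by
      simp only [η, add_sub_add_left_eq_sub, ← sub_smul]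
      congr 1; ring
    rw [dist_eq_norm, h1, norm_smul, ← dist_eq_norm, dist_comm q, ← hσ, norm_div,
      Real.norm_of_nonneg hσ0, Real.norm_eq_abs, abs_sub_comm]
    -- For `σ = 0` the quotient is zero.
    rcases hσ0.eq_or_lt with h | h
    · rw [← h]; simp
    · rw [div_mul_cancel₀ _ h.ne']
  have hηl : η l = γ l := by simp [η, hγ.finish]
  have hηQ : ∀ t, l ≤ t → t ≤ l + σ → η t ∈ Q.carrier := by
    intro t h1 h2
    exact Q.add_smul_mem hx₀ ⟨div_nonneg (by linarith) hσ0, div_le_one_of_le₀ (by linarith) hσ0⟩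
  let Γ : ℝ → EuclideanSpace ℝ (Fin n) := fun t => if t ≤ l then γ t else η t
  have hΓ1 : ∀ t, t ≤ l → Γ t = γ t := fun t ht => if_pos ht
  have hΓ2 : ∀ t, l ≤ t → Γ t = η t := by
    intro t ht
    rcases ht.eq_or_lt with h | h
    · rw [← h, hΓ1 l le_rfl, hηl]
    · exact if_neg (not_le.2 h)
  have hΓLip : ∀ s ∈ Icc 0 (l + σ), ∀ t ∈ Icc 0 (l + σ), s ≤ t → dist (Γ s) (Γ t) ≤ t - s := by
    intro s hs t ht hst
    rcases le_total t l with h1 | h1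
    · rw [hΓ1 t h1, hΓ1 s (hst.trans h1)]
      exact hLip s ⟨hs.1, hst.trans h1⟩ t ⟨ht.1, h1⟩ hst
    · rcases le_total s l with h2 | h2
      · rw [hΓ1 s h2, hΓ2 t h1]
        have h3 := hLip s ⟨hs.1, h2⟩ l ⟨hl, le_rfl⟩ h2
        have h4 := hη l t
        rw [hηl, abs_of_nonneg (by linarith)] at h4
        linarith [dist_triangle (γ s) (γ l) (η t)]
      · rw [hΓ2 s h2, hΓ2 t h1]
        exact (hη s t).trans (abs_of_nonneg (by linarith)).le
  refine ⟨l + σ, Γ, by linarith, ?_, ?_, fun s hs t ht => ?_, fun t ht => ?_, hlσ⟩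
  · rw [hΓ1 0 hl, hγ.start]
  · rw [hΓ2 _ (by linarith)]
    simp only [η, add_sub_cancel_left]
    rcases hσ0.eq_or_lt with h | h
    · rw [← h]; simpa using dist_eq_zero.1 (hσ.symm.trans h.symm)
    · rw [div_self h.ne', one_smul, add_sub_cancel]
  · rcases le_total s t with h | h
    · exact (hΓLip s hs t ht h).trans (le_abs_self _)
    · rw [dist_comm, abs_sub_comm]
      exact (hΓLip t ht s hs h).trans (le_abs_self _)
  · rcases le_total t l with h | h
    · rw [hΓ1 t h]
      refine ⟨hγ.mapsTo ⟨ht.1, h⟩, le_trans ?_ (hγ.john t ⟨ht.1, h⟩)⟩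
      exact div_le_div_of_nonneg_left ht.1 hc₀ hcc
    · rw [hΓ2 t h]
      have h1 := hηQ t h ht.2
      refine ⟨hW.carrier_subset hQ h1, le_trans ?_ (hW.two_mul_halfSide_le_infDist hn hQ hF h1)⟩
      have h2 : t / (n * (11 * c₀ + 2)) ≤ (l + σ) / (n * (11 * c₀ + 2)) := by
        have := ht.2
        gcongr
      linarith

/-! ### The gradient controls the oscillation along a John curve -/

theorem sum_geometric_le {τ : ℝ} (hτ : 1 < τ) {ρ : ℝ} (hρ : 0 ≤ ρ) {b : ℝ} (hb : 0 ≤ b) (N : ℕ) :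
    ∑ k ∈ Finset.range N, (if ρ / τ ^ k ≤ b then ρ / τ ^ k else 0) ≤ b * (τ / (τ - 1)) := by
  have hτ0 : 0 < τ := by linarith
  have h1 : ∀ k, (if ρ / τ ^ k ≤ b then ρ / τ ^ k else 0)
      ≤ (τ / (τ - 1)) * (min (ρ / τ ^ k) b - min (ρ / τ ^ (k + 1)) b) := by
    intro k
    have h0 : 0 ≤ ρ / τ ^ k := by positivity
    have h2 : ρ / τ ^ (k + 1) = ρ / τ ^ k / τ := by rw [pow_succ, div_div]
    have h3 : ρ / τ ^ k / τ ≤ ρ / τ ^ k := div_le_self h0 hτ.le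
    rw [h2]
    have h4 : 0 < τ - 1 := by linarith
    split_ifs with h
    · rw [min_eq_left h, min_eq_left (h3.trans h)]
      apply le_of_eq
      field_simp
    · exact mul_nonneg (by positivity) (sub_nonneg.2 (min_le_min_right b h3))
  refine (Finset.sum_le_sum fun k _ => h1 k).trans ?_
  rw [← Finset.mul_sum, Finset.sum_range_sub' (fun k => min (ρ / τ ^ k) b), mul_comm]
  have h4 : 0 < τ - 1 := by linarith
  refine mul_le_mul_of_nonneg_right ?_ (by positivity)
  have h5 : 0 ≤ min (ρ / τ ^ N) b := le_min (by positivity) hb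
  have h6 := min_le_right (ρ / τ ^ 0) b
  linarith

theorem closedBall_subset_of_lt_infDist_frontier {n : ℕ} {Ω : Set (EuclideanSpace ℝ (Fin n))}
    (hΩ : IsOpen Ω) {p : EuclideanSpace ℝ (Fin n)} (hp : p ∈ Ω) {r : ℝ} (hr : 0 ≤ r)
    (h : r < Metric.infDist p (frontier Ω)) : Metric.closedBall p r ⊆ Ω := by
  have hconn : IsPreconnected (Metric.closedBall p r) := (convex_closedBall p r).isPreconnected
  refine hconn.subset_left_of_subset_union hΩ (isClosed_closure (s := Ω)).isOpen_compl
    (disjoint_compl_right.mono_left subset_closure) (fun z hz => ?_)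
    ⟨p, Metric.mem_closedBall_self hr, hp⟩
  by_contra hcon
  rw [mem_union, not_or, mem_compl_iff, not_not] at hcon
  have hzF : z ∈ frontier Ω := by
    rw [hΩ.frontier_eq]; exact ⟨hcon.2, hcon.1⟩
  have := Metric.infDist_le_dist_of_mem (x := p) hzF
  rw [Metric.mem_closedBall, dist_comm] at hz
  linarith

/-- The set of points of `Ω` whose distance to the boundary is comparable to their distance to the
boundary point `a`, and not much smaller than `δ`. -/
def nontangentialRegion {n : ℕ} (Ω : Set (EuclideanSpace ℝ (Fin n))) (A δ : ℝ)
    (a : EuclideanSpace ℝ (Fin n)) : Set (EuclideanSpace ℝ (Fin n)) :=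
  {z | dist a z ≤ A * Metric.infDist z (frontier Ω) ∧ δ ≤ A * Metric.infDist z (frontier Ω)}

theorem measurableSet_nontangentialRegion {n : ℕ} (Ω : Set (EuclideanSpace ℝ (Fin n))) (A δ : ℝ)
    (a : EuclideanSpace ℝ (Fin n)) : MeasurableSet (nontangentialRegion Ω A δ a) := by
  have h : Continuous fun z => A * Metric.infDist z (frontier Ω) :=
    continuous_const.mul (Metric.continuous_infDist_pt _)
  exact (isClosed_le (by fun_prop) h).measurableSet.inter
    (isClosed_le continuous_const h).measurableSet

/-- A Sobolev function that is at most `1 / 2` in `Ω` near the boundary point `a`, and at least `1`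
near the endpoint `q` of the John curves, has a potential of its gradient bounded below at `a`.
The averages over the balls of radius `t / (4 c)` about the points `γ t`, for `t` in a geometric
progression, are telescoped; the balls containing a given point `z` have radii comparable to the
distance of `z` to the boundary. -/
theorem IsSobolevWithGradient.one_half_le_potential {n : ℕ}
    {Ω : Set (EuclideanSpace ℝ (Fin n))} (hΩ : IsOpen Ω)
    {φ u : EuclideanSpace ℝ (Fin n) → ℝ} {g : EuclideanSpace ℝ (Fin n) → EuclideanSpace ℝ (Fin n)}
    (h : IsSobolevWithGradient Ω u g) (hvol : volume Ω ≠ ⊤)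
    (hu : IntegrableOn u Ω) (hg : IntegrableOn g Ω) (hφ : IsAveragingKernel φ)
    {K : ℝ} (hK : ∀ y, φ y ≤ K) {c : ℝ} (hc : 1 ≤ c) {x q a : EuclideanSpace ℝ (Fin n)}
    (ha : a ∈ frontier Ω) {l δ : ℝ} {γ : ℝ → EuclideanSpace ℝ (Fin n)}
    (hl : 0 ≤ l) (hγ0 : γ 0 = x) (hγl : γ l = q)
    (hγLip : ∀ s ∈ Icc 0 l, ∀ t ∈ Icc 0 l, dist (γ s) (γ t) ≤ |t - s|)
    (hγ : ∀ t ∈ Icc 0 l, γ t ∈ Ω ∧ t / c ≤ Metric.infDist (γ t) (frontier Ω))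
    (hδ : 0 < δ) (hδq : 2 * δ ≤ Metric.infDist q (frontier Ω)) (hxa : dist x a < δ)
    (hua : ∀ z ∈ Ω, dist z a < 4 * δ → u z ≤ 1 / 2)
    (huq : ∀ z ∈ Metric.closedBall q (l / c), 1 ≤ u z) :
    2⁻¹ ≤ ENNReal.ofReal (2 * K * (12 * c) ^ n * (4 * c + 1)) *
      ∫⁻ z in Ω, (nontangentialRegion Ω (12 * c) δ a).indicator (fun z => ‖g z‖ₑ *
        ENNReal.ofReal (Metric.infDist z (frontier Ω) *
          (Metric.infDist z (frontier Ω) ^ n)⁻¹)) z := by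
  have hK0 : 0 ≤ K := (hφ.nonneg 0).trans (hK 0)
  have hc0 : 0 < c := by linarith
  have hlδ : δ ≤ l := by
    have h1 := Metric.infDist_le_dist_of_mem (x := q) ha
    have h2 := hγLip 0 ⟨le_rfl, hl⟩ l ⟨hl, le_rfl⟩
    rw [hγ0, hγl, sub_zero, abs_of_nonneg hl, dist_comm] at h2
    linarith [dist_triangle q x a]
  set τ : ℝ := 1 + 1 / (4 * c) with hτdef
  have hτinv : 0 < 1 / (4 * c) := by positivity
  have hτinv1 : 1 / (4 * c) ≤ 1 := by rw [div_le_one (by positivity)]; linarith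
  have hτ : 1 < τ := by linarith
  have hτ0 : 0 < τ := by linarith
  obtain ⟨N, hN1, hN2⟩ := exists_nat_pow_near ((one_le_div hδ).2 hlδ) hτ
  set t : ℕ → ℝ := fun k => l / τ ^ k with htdef
  have htN : ∀ k ≤ N, δ ≤ t k := by
    intro k hk
    rw [htdef]; simp only
    rw [le_div_iff₀ (by positivity), mul_comm, ← le_div_iff₀ hδ]
    exact (pow_le_pow_right₀ hτ.le hk).trans hN1
  have htl : ∀ k, t k ≤ l := fun k => div_le_self hl (one_le_pow₀ hτ.le)
  have ht0 : ∀ k, 0 ≤ t k := fun k => by simp only [htdef]; positivity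
  have htm : ∀ k, t k ∈ Icc 0 l := fun k => ⟨ht0 k, htl k⟩
  have hts : ∀ k, t k - t (k + 1) = t (k + 1) / (4 * c) := by
    intro k
    have h1 : t k = τ * t (k + 1) := by simp only [htdef]; rw [pow_succ]; field_simp
    rw [h1, hτdef]; ring
  have htN2 : t N ≤ 2 * δ := by
    simp only [htdef]
    rw [div_le_iff₀ (by positivity)]
    rw [div_lt_iff₀ hδ, pow_succ] at hN2
    have h2 : 0 < τ ^ N := by positivity
    have h3 : τ ≤ 2 := by linarith
    have h4 : τ ^ N * τ * δ ≤ τ ^ N * 2 * δ := by gcongr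
    linarith
  let Φ : ℕ → ℝ := fun k => smoothAverage Ω φ u (γ (t k)) (t k / (4 * c))
  have hsub : ∀ k ≤ N, Metric.closedBall (γ (t k)) (3 * (t k / (4 * c))) ⊆ Ω := by
    intro k hk
    have h1 := (hγ _ (htm k)).2
    have h2 : 0 < t k / (4 * c) := div_pos (hδ.trans_le (htN k hk)) (by positivity)
    have h3 : t k / c = 4 * (t k / (4 * c)) := by field_simp
    exact closedBall_subset_of_lt_infDist_frontier hΩ (hγ _ (htm k)).1 (by positivity) (by linarith)
  have hΦ0 : 1 ≤ Φ 0 := by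
    have h1 : t 0 = l := by simp [htdef]
    have h2 : 0 < l := hδ.trans_le hlδ
    have h3 : Metric.closedBall (γ (t 0)) (t 0 / (4 * c)) ⊆ Ω :=
      (Metric.closedBall_subset_closedBall (by
        have : 0 ≤ t 0 / (4 * c) := by rw [h1]; positivity
        linarith)).trans (hsub 0 (Nat.zero_le _))
    have h4 : 0 < t 0 / (4 * c) := by rw [h1]; positivity
    rw [← smoothAverage_const hφ h4 h3 1]
    refine smoothAverage_mono (integrableOn_const hvol) hu hφ h4 fun z hz => huq z ?_
    rw [h1, hγl] at hz
    refine Metric.closedBall_subset_closedBall ?_ hz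
    exact div_le_div_of_nonneg_left hl hc0 (by linarith)
  have hΦN : Φ N ≤ 1 / 2 := by
    have h4 : 0 < t N / (4 * c) := div_pos (hδ.trans_le (htN N le_rfl)) (by positivity)
    have h3 : Metric.closedBall (γ (t N)) (t N / (4 * c)) ⊆ Ω :=
      (Metric.closedBall_subset_closedBall (by linarith)).trans (hsub N le_rfl)
    rw [← smoothAverage_const hφ h4 h3 (1 / 2)]
    refine smoothAverage_mono hu (integrableOn_const hvol) hφ h4 fun z hz => hua z (h3 hz) ?_
    have h5 := hγLip 0 ⟨le_rfl, hl⟩ _ (htm N)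
    rw [hγ0, sub_zero, abs_of_nonneg (ht0 N), dist_comm] at h5
    have h6 : t N / (4 * c) ≤ t N / 4 :=
      div_le_div_of_nonneg_left (ht0 N) (by norm_num) (by linarith)
    rw [Metric.mem_closedBall] at hz
    linarith [dist_triangle z (γ (t N)) a, dist_triangle (γ (t N)) x a]
  let ρ : ℕ → ℝ := fun k => t (k + 1) / (4 * c)
  let B : ℕ → Set (EuclideanSpace ℝ (Fin n)) := fun k => Metric.closedBall (γ (t (k + 1))) (3 * ρ k)
  have hρ0 : ∀ k < N, 0 < ρ k := fun k hk =>
    div_pos (hδ.trans_le (htN (k + 1) hk)) (by positivity)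
  have hstep : ∀ k < N, |Φ k - Φ (k + 1)| ≤ 2 * K * (ρ k * (ρ k ^ n)⁻¹) * ∫ z in B k, ‖g z‖ := by
    intro k hk
    have hρ := hρ0 k hk
    have hr : t k / (4 * c) - ρ k = ρ k * (1 / (4 * c)) := by
      rw [← sub_div, hts]; simp only [ρ]; ring
    have hs0 : 0 ≤ t k / (4 * c) - ρ k := by rw [hr]; positivity
    have hs1 : t k / (4 * c) - ρ k ≤ ρ k := by
      rw [hr]; exact mul_le_of_le_one_right hρ.le hτinv1
    have hv : ‖γ (t k) - γ (t (k + 1))‖ ≤ ρ k := by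
      have h1 := hγLip _ (htm (k + 1)) _ (htm k)
      rw [hts, abs_of_pos hρ, dist_comm, dist_eq_norm] at h1
      exact h1
    have := h.abs_smoothAverage_sub_le hu hg hφ hK hρ (p := γ (t (k + 1)))
      (v := γ (t k) - γ (t (k + 1))) (r := ρ k) (s := t k / (4 * c) - ρ k) (B := B k)
      Metric.isClosed_closedBall.measurableSet (hsub (k + 1) hk)
      (fun θ hθ => le_add_of_nonneg_right (mul_nonneg hθ.1 hs0))
      (fun θ hθ => by
        refine Metric.closedBall_subset_closedBall' ?_
        rw [dist_eq_norm, add_sub_cancel_left, norm_smul, Real.norm_of_nonneg hθ.1]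
        have h1 : θ * (t k / (4 * c) - ρ k) ≤ ρ k := (mul_le_of_le_one_left hs0 hθ.2).trans hs1
        have h2 : θ * ‖γ (t k) - γ (t (k + 1))‖ ≤ ρ k :=
          (mul_le_of_le_one_left (norm_nonneg _) hθ.2).trans hv
        linarith)
    rw [add_sub_cancel, add_sub_cancel] at this
    refine this.trans ?_
    rw [abs_of_nonneg hs0]
    have h3 : K * (‖γ (t k) - γ (t (k + 1))‖ + (t k / (4 * c) - ρ k)) ≤ 2 * K * ρ k := by
      calc _ ≤ K * (ρ k + ρ k) := by gcongr
        _ = _ := by ring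
    have h4 : 0 ≤ (ρ k ^ n)⁻¹ := by positivity
    have h5 : 0 ≤ ∫ z in B k, ‖g z‖ := integral_nonneg fun z => norm_nonneg _
    calc _ ≤ 2 * K * ρ k * (ρ k ^ n)⁻¹ * ∫ z in B k, ‖g z‖ := by gcongr
      _ = _ := by ring
  have htel : (1 : ℝ) / 2 ≤
      ∑ k ∈ Finset.range N, 2 * K * (ρ k * (ρ k ^ n)⁻¹) * ∫ z in B k, ‖g z‖ := by
    have h1 := Finset.sum_range_sub' Φ N
    have h2 : ∑ k ∈ Finset.range N, (Φ k - Φ (k + 1)) ≤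
        ∑ k ∈ Finset.range N, 2 * K * (ρ k * (ρ k ^ n)⁻¹) * ∫ z in B k, ‖g z‖ :=
      Finset.sum_le_sum fun k hk => (le_abs_self _).trans (hstep k (Finset.mem_range.1 hk))
    linarith
  -- The pointwise bound for the sum of the kernels `ρ ^ (1 - n)` of the balls.
  have hpt : ∀ z, ∑ k ∈ Finset.range N, (B k).indicator
      (fun _ => 2 * K * (ρ k * (ρ k ^ n)⁻¹)) z ≤
      (nontangentialRegion Ω (12 * c) δ a).indicator (fun z =>
        2 * K * (12 * c) ^ n * (4 * c + 1) * (Metric.infDist z (frontier Ω) *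
          (Metric.infDist z (frontier Ω) ^ n)⁻¹)) z := by
    intro z
    set d := Metric.infDist z (frontier Ω) with hd
    have hd0 : 0 ≤ d := Metric.infDist_nonneg
    have hB : ∀ k < N, z ∈ B k → ρ k ≤ d ∧ d ≤ 12 * c * ρ k ∧
        z ∈ nontangentialRegion Ω (12 * c) δ a := by
      intro k hk hz
      have hz' : dist z (γ (t (k + 1))) ≤ 3 * ρ k := hz
      have h1 := (hγ _ (htm (k + 1))).2
      have h2 : t (k + 1) / c = 4 * ρ k := by simp only [ρ]; field_simp
      have h2' : t (k + 1) = 4 * c * ρ k := by simp only [ρ]; field_simp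
      have h3 := Metric.infDist_le_infDist_add_dist (s := frontier Ω) (x := γ (t (k + 1))) (y := z)
      rw [dist_comm] at h3
      have h4 : ρ k ≤ d := by linarith
      have h5 := hγLip 0 ⟨le_rfl, hl⟩ _ (htm (k + 1))
      rw [hγ0, sub_zero, abs_of_nonneg (ht0 _), dist_comm] at h5
      have h6 := dist_triangle z (γ (t (k + 1))) a
      have h7 := dist_triangle (γ (t (k + 1))) x a
      have h8 := htN (k + 1) hk
      have h9 : ρ k ≤ c * ρ k := le_mul_of_one_le_left (hρ0 k hk).le hc
      have h10 : dist z a ≤ 12 * c * ρ k := by linarith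
      have h11 : 12 * c * ρ k ≤ 12 * c * d := by gcongr
      have h12 : d ≤ dist z a := Metric.infDist_le_dist_of_mem ha
      refine ⟨h4, by linarith, ?_, ?_⟩
      · rw [dist_comm]; exact h10.trans h11
      · change δ ≤ 12 * c * d
        linarith [hρ0 k hk]
    by_cases hz : z ∈ nontangentialRegion Ω (12 * c) δ a
    · rw [indicator_of_mem hz]
      have hdp : 0 < d := by
        by_contra hcon
        have h1 : δ ≤ 12 * c * d := hz.2
        have h2 : d = 0 := le_antisymm (not_lt.1 hcon) hd0
        rw [h2] at h1; linarith
      calc ∑ k ∈ Finset.range N, (B k).indicator (fun _ => 2 * K * (ρ k * (ρ k ^ n)⁻¹)) z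
          ≤ ∑ k ∈ Finset.range N, 2 * K * (12 * c) ^ n * (d ^ n)⁻¹ *
            (if l / τ / (4 * c) / τ ^ k ≤ d then l / τ / (4 * c) / τ ^ k else 0) := by
            refine Finset.sum_le_sum fun k hk => ?_
            have hk := Finset.mem_range.1 hk
            have hρk : l / τ / (4 * c) / τ ^ k = ρ k := by
              simp only [ρ, htdef]; rw [pow_succ]; field_simp
            rw [hρk]
            by_cases hzk : z ∈ B k
            · obtain ⟨h1, h2, -⟩ := hB k hk hzk
              rw [indicator_of_mem hzk, if_pos h1]
              have h3 : (ρ k ^ n)⁻¹ ≤ (12 * c) ^ n * (d ^ n)⁻¹ := by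
                rw [← div_eq_mul_inv, inv_le_comm₀ (pow_pos (hρ0 k hk) n) (by positivity), inv_div,
                  div_le_iff₀ (by positivity), ← mul_pow, mul_comm (ρ k)]
                exact pow_le_pow_left₀ hd0 h2 n
              have := hρ0 k hk
              calc 2 * K * (ρ k * (ρ k ^ n)⁻¹)
                  ≤ 2 * K * (ρ k * ((12 * c) ^ n * (d ^ n)⁻¹)) := by gcongr
                _ = _ := by ring
            · rw [indicator_of_notMem hzk]
              refine mul_nonneg (by positivity) ?_
              split_ifs
              · exact (hρ0 k hk).le
              · exact le_rfl
        _ ≤ 2 * K * (12 * c) ^ n * (d ^ n)⁻¹ * (d * (τ / (τ - 1))) := by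
            rw [← Finset.mul_sum]
            refine mul_le_mul_of_nonneg_left ?_ (by positivity)
            exact sum_geometric_le hτ (by positivity) hd0 N
        _ = _ := by
            have : τ / (τ - 1) = 4 * c + 1 := by rw [hτdef]; field_simp; ring
            rw [this]; ring
    · rw [indicator_of_notMem hz, Finset.sum_eq_zero]
      intro k hk
      exact indicator_of_notMem (fun hzk => hz (hB k (Finset.mem_range.1 hk) hzk).2.2) _
  have hw0 : ∀ k < N, 0 ≤ 2 * K * (ρ k * (ρ k ^ n)⁻¹) := fun k hk => by
    have := hρ0 k hk; positivity
  calc (2⁻¹ : ℝ≥0∞) = ENNReal.ofReal (1 / 2) := by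
        rw [one_div, ENNReal.ofReal_inv_of_pos two_pos]; simp
    _ ≤ ENNReal.ofReal (∑ k ∈ Finset.range N, 2 * K * (ρ k * (ρ k ^ n)⁻¹) * ∫ z in B k, ‖g z‖) :=
        ENNReal.ofReal_le_ofReal htel
    _ = ∑ k ∈ Finset.range N, ∫⁻ z in Ω, ‖g z‖ₑ *
          ENNReal.ofReal ((B k).indicator (fun _ => 2 * K * (ρ k * (ρ k ^ n)⁻¹)) z) := by
        rw [ENNReal.ofReal_sum_of_nonneg fun k hk => mul_nonneg (hw0 k (Finset.mem_range.1 hk))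
          (integral_nonneg fun z => norm_nonneg _)]
        refine Finset.sum_congr rfl fun k hk => ?_
        have hk := Finset.mem_range.1 hk
        have hBΩ : B k ⊆ Ω := hsub (k + 1) hk
        have hBm : MeasurableSet (B k) := Metric.isClosed_closedBall.measurableSet
        have hset : ∀ F : EuclideanSpace ℝ (Fin n) → ℝ≥0∞,
            ∫⁻ z in B k, F z = ∫⁻ z in Ω, (B k).indicator F z := fun F => by
          rw [setLIntegral_indicator hBm, inter_eq_left.2 hBΩ]
        rw [ENNReal.ofReal_mul (hw0 k hk),
          ofReal_integral_norm_eq_lintegral_enorm (hg.mono_set hBΩ),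
          ← lintegral_const_mul' _ _ ENNReal.ofReal_ne_top, hset]
        refine lintegral_congr fun z => ?_
        by_cases hz : z ∈ B k
        · simp only [indicator_of_mem hz]; rw [mul_comm]
        · simp only [indicator_of_notMem hz]; simp
    _ = ∫⁻ z in Ω, ∑ k ∈ Finset.range N, ‖g z‖ₑ *
          ENNReal.ofReal ((B k).indicator (fun _ => 2 * K * (ρ k * (ρ k ^ n)⁻¹)) z) := by
        refine (lintegral_finsetSum' _ fun k _ => ?_).symm
        exact hg.aestronglyMeasurable.enorm.mul
          (measurable_const.indicator
            Metric.isClosed_closedBall.measurableSet).ennreal_ofReal.aemeasurable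
    _ ≤ ∫⁻ z in Ω, ENNReal.ofReal (2 * K * (12 * c) ^ n * (4 * c + 1)) *
          (nontangentialRegion Ω (12 * c) δ a).indicator (fun z => ‖g z‖ₑ *
          ENNReal.ofReal (Metric.infDist z (frontier Ω) *
          (Metric.infDist z (frontier Ω) ^ n)⁻¹)) z := by
        refine lintegral_mono fun z => ?_
        simp only
        rw [← Finset.mul_sum, ← ENNReal.ofReal_sum_of_nonneg fun k hk =>
          indicator_nonneg (fun _ _ => hw0 k (Finset.mem_range.1 hk)) z]
        refine (mul_le_mul_right (ENNReal.ofReal_le_ofReal (hpt z)) _).trans (le_of_eq ?_)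
        by_cases hz : z ∈ nontangentialRegion Ω (12 * c) δ a
        · simp only [indicator_of_mem hz]
          rw [ENNReal.ofReal_mul (by positivity)]; ring
        · simp only [indicator_of_notMem hz]; simp
    _ = _ := lintegral_const_mul' _ _ ENNReal.ofReal_ne_top

/-! ### A radial integral -/

theorem lintegral_ofReal_radial {n : ℕ} (hn : 0 < n) (a : EuclideanSpace ℝ (Fin n)) {f F : ℝ → ℝ}
    (hf : ∀ r, 0 ≤ f r) (hF : IntegrableOn F (Ioi 0))
    (hfF : ∀ r, 0 < r → r ^ (n - 1) * f r = F r) :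
    ∫⁻ z, ENNReal.ofReal (f (dist a z)) = ENNReal.ofReal
      (n * volume.real (Metric.ball (0 : EuclideanSpace ℝ (Fin n)) 1) * ∫ r in Ioi 0, F r) := by
  have : Nonempty (Fin n) := ⟨⟨0, hn⟩⟩
  have h1 : Integrable (fun z : EuclideanSpace ℝ (Fin n) => f ‖z‖) := by
    rw [integrable_fun_norm_addHaar]
    simp only [finrank_euclideanSpace, Fintype.card_fin, smul_eq_mul]
    exact hF.congr_fun (fun r hr => (hfF r hr).symm) measurableSet_Ioi
  have h2 := integral_fun_norm_addHaar (volume : Measure (EuclideanSpace ℝ (Fin n))) f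
  simp only [finrank_euclideanSpace, Fintype.card_fin, smul_eq_mul, nsmul_eq_mul] at h2
  rw [setIntegral_congr_fun measurableSet_Ioi fun r hr => hfF r hr] at h2
  simp_rw [dist_comm a, dist_eq_norm]
  rw [lintegral_sub_right_eq_self (fun z => ENNReal.ofReal (f ‖z‖)) a,
    ← ofReal_integral_eq_lintegral_ofReal h1 (Filter.Eventually.of_forall fun z => hf _), h2,
    mul_assoc]

theorem integrableOn_and_integral_Icc_inv {M : ℝ} (hM : 0 < M) (hM1 : M ≤ 1) :
    IntegrableOn ((Icc M 1).indicator fun r => r⁻¹) (Ioi 0) ∧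
      ∫ r in Ioi 0, (Icc M 1).indicator (fun r => r⁻¹) r = Real.log (1 / M) := by
  have hsub : Icc M 1 ⊆ Ioi 0 := fun r hr => hM.trans_le hr.1
  have h1 : IntervalIntegrable (fun r : ℝ => r⁻¹) volume M 1 := by
    refine ContinuousOn.intervalIntegrable (continuousOn_id.inv₀ fun r hr => ?_)
    rw [uIcc_of_le hM1] at hr
    exact (hsub hr).ne'
  constructor
  · exact (((intervalIntegrable_iff_integrableOn_Icc_of_le hM1).1 h1).integrable_indicator
      measurableSet_Icc).integrableOn
  · rw [setIntegral_indicator measurableSet_Icc, inter_eq_right.2 hsub,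
      integral_Icc_eq_integral_Ioc, ← intervalIntegral.integral_of_le hM1,
      integral_inv_of_pos hM one_pos]

theorem integrableOn_and_integral_Ioo_rpow {M σ : ℝ} (hM : 0 < M) (hσ : 0 < σ) :
    IntegrableOn ((Ioo 0 M).indicator fun r => r ^ (σ - 1)) (Ioi 0) ∧
      ∫ r in Ioi 0, (Ioo 0 M).indicator (fun r => r ^ (σ - 1)) r = M ^ σ / σ := by
  have hsub : Ioo 0 M ⊆ Ioi 0 := fun r hr => hr.1
  have h1 : IntervalIntegrable (fun r : ℝ => r ^ (σ - 1)) volume 0 M :=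
    intervalIntegral.intervalIntegrable_rpow' (by linarith)
  constructor
  · exact (((intervalIntegrable_iff_integrableOn_Ioo_of_le hM.le).1 h1).integrable_indicator
      measurableSet_Ioo).integrableOn
  · rw [setIntegral_indicator measurableSet_Ioo, inter_eq_right.2 hsub,
      ← integral_Ioc_eq_integral_Ioo, ← intervalIntegral.integral_of_le hM.le,
      integral_rpow (Or.inl (by linarith))]
    simp [Real.zero_rpow hσ.ne']

theorem one_add_log_le_two_mul_sqrt {y : ℝ} (hy : 0 < y) :
    1 + Real.log y ≤ 2 * y ^ (1 / 2 : ℝ) := by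
  have h1 := Real.log_le_sub_one_of_pos (Real.rpow_pos_of_pos hy (1 / 2))
  rw [Real.log_rpow hy] at h1
  linarith

/-- The integrand is estimated separately for `|z - a| ≥ M`, where the logarithm is bounded by its
value at `M`, and for `|z - a| < M`, where a small power of `M / |z - a|` absorbs it. -/
theorem exists_lintegral_log_le {n : ℕ} (hn : 0 < n) {A s β : ℝ} (hA : 1 ≤ A) (hs : 0 < s)
    (hs1 : s ≤ 1) (hβ : 0 ≤ β) (hβs : β ≤ s) :
    ∃ K : ℝ, 0 < K ∧ ∀ (M : ℝ), 0 < M → M ≤ 1 → ∀ a : EuclideanSpace ℝ (Fin n),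
      ∫⁻ z in Metric.closedBall a 1, ENNReal.ofReal ((dist a z ^ n)⁻¹ * min M (A * dist a z) ^ s
          * (1 + Real.log (1 / dist a z)) ^ β)
        ≤ ENNReal.ofReal (K * (M ^ s * (1 + Real.log (1 / M)) ^ (1 + β))) := by
  set V := volume.real (Metric.ball (0 : EuclideanSpace ℝ (Fin n)) 1) with hV
  have hV0 : 0 ≤ V := measureReal_nonneg
  refine ⟨n * V * (1 + 4 * A / s) + 1, by positivity, fun M hM hM1 a => ?_⟩
  set Λ := 1 + Real.log (1 / M) with hΛ
  have hlogM : 0 ≤ Real.log (1 / M) := Real.log_nonneg ((one_le_div hM).2 hM1)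
  have hΛ1 : 1 ≤ Λ := by linarith
  have hΛ0 : 0 < Λ := by linarith
  let f₁ : ℝ → ℝ := fun r => M ^ s * Λ ^ β * (Icc M 1).indicator (fun r => (r ^ n)⁻¹) r
  let f₂ : ℝ → ℝ := fun r => 2 * A * Λ ^ β * M ^ (s / 2) *
    (Ioo 0 M).indicator (fun r => (r ^ n)⁻¹ * r ^ (s / 2)) r
  have hf₁ : ∀ r, 0 ≤ f₁ r := fun r => mul_nonneg (by positivity)
    (indicator_nonneg (fun r hr => inv_nonneg.2 (pow_nonneg (hM.le.trans hr.1) _)) r)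
  have hf₂ : ∀ r, 0 ≤ f₂ r := fun r => mul_nonneg (by positivity)
    (indicator_nonneg (fun r hr => mul_nonneg (inv_nonneg.2 (pow_nonneg hr.1.le _))
      (Real.rpow_nonneg hr.1.le _)) r)
  have hpt : ∀ r, 0 ≤ r → r ≤ 1 →
      (r ^ n)⁻¹ * min M (A * r) ^ s * (1 + Real.log (1 / r)) ^ β ≤ f₁ r + f₂ r := by
    intro r hr0 hr1
    rcases hr0.eq_or_lt with h0 | h0
    · rw [← h0, zero_pow hn.ne']
      simpa using add_nonneg (hf₁ 0) (hf₂ 0)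
    have hlogr : 0 ≤ Real.log (1 / r) := Real.log_nonneg ((one_le_div h0).2 hr1)
    have hmin : 0 ≤ min M (A * r) := le_min hM.le (by positivity)
    rcases le_or_gt M r with h | h
    · have h1 : min M (A * r) ^ s ≤ M ^ s := Real.rpow_le_rpow hmin (min_le_left _ _) hs.le
      have h2 : (1 + Real.log (1 / r)) ^ β ≤ Λ ^ β := by
        refine Real.rpow_le_rpow (by linarith) ?_ hβ
        have := Real.log_le_log (by positivity) (one_div_le_one_div_of_le hM h)
        linarith
      have h3 : f₁ r = M ^ s * Λ ^ β * (r ^ n)⁻¹ := by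
        simp only [f₁]; rw [indicator_of_mem (show r ∈ Icc M 1 from ⟨h, hr1⟩)]
      have h4 := hf₂ r
      calc (r ^ n)⁻¹ * min M (A * r) ^ s * (1 + Real.log (1 / r)) ^ β
          ≤ (r ^ n)⁻¹ * M ^ s * Λ ^ β := by gcongr
        _ = f₁ r := by rw [h3]; ring
        _ ≤ _ := by linarith
    · have hy : 1 ≤ M / r := (one_le_div h0).2 h.le
      have h1 : min M (A * r) ^ s ≤ A * r ^ s := by
        calc min M (A * r) ^ s ≤ (A * r) ^ s := Real.rpow_le_rpow hmin (min_le_right _ _) hs.le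
          _ = A ^ s * r ^ s := Real.mul_rpow (by linarith) hr0
          _ ≤ A * r ^ s := by
            gcongr
            simpa using Real.rpow_le_rpow_of_exponent_le hA hs1
      have h2 : 1 + Real.log (1 / r) ≤ Λ * (2 * (M / r) ^ (1 / 2 : ℝ)) := by
        have h3 := one_add_log_le_two_mul_sqrt (y := M / r) (by positivity)
        have h4 : Real.log (1 / r) = Real.log (1 / M) + Real.log (M / r) := by
          rw [← Real.log_mul (by positivity) (by positivity)]
          congr 1; field_simp
        have h5 : 0 ≤ Real.log (M / r) := Real.log_nonneg hy
        calc 1 + Real.log (1 / r) ≤ Λ * (1 + Real.log (M / r)) := by rw [h4, hΛ]; nlinarith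
          _ ≤ _ := by gcongr
      have h3 : (1 + Real.log (1 / r)) ^ β ≤ 2 * Λ ^ β * (M / r) ^ (s / 2) := by
        calc (1 + Real.log (1 / r)) ^ β ≤ (Λ * (2 * (M / r) ^ (1 / 2 : ℝ))) ^ β :=
              Real.rpow_le_rpow (by linarith) h2 hβ
          _ = 2 ^ β * Λ ^ β * (M / r) ^ (1 / 2 * β) := by
              rw [Real.mul_rpow hΛ0.le (by positivity), Real.mul_rpow two_pos.le (by positivity),
                ← Real.rpow_mul (by positivity)]
              ring
          _ ≤ 2 * Λ ^ β * (M / r) ^ (s / 2) := by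
              have h4 : (2 : ℝ) ^ β ≤ 2 := by
                simpa using Real.rpow_le_rpow_of_exponent_le one_le_two (hβs.trans hs1)
              have h5 : (M / r) ^ (1 / 2 * β) ≤ (M / r) ^ (s / 2) :=
                Real.rpow_le_rpow_of_exponent_le hy (by linarith)
              gcongr
      have h4 : f₂ r = 2 * A * Λ ^ β * M ^ (s / 2) * ((r ^ n)⁻¹ * r ^ (s / 2)) := by
        simp only [f₂]; rw [indicator_of_mem (show r ∈ Ioo 0 M from ⟨h0, h⟩)]
      have h5 : r ^ s = r ^ (s / 2) * r ^ (s / 2) := by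
        rw [← Real.rpow_add h0]; congr 1; ring
      have h6 := hf₁ r
      calc (r ^ n)⁻¹ * min M (A * r) ^ s * (1 + Real.log (1 / r)) ^ β
          ≤ (r ^ n)⁻¹ * (A * r ^ s) * (2 * Λ ^ β * (M / r) ^ (s / 2)) := by gcongr
        _ = f₂ r := by
            rw [h4, h5, Real.div_rpow hM.le hr0]
            have : r ^ (s / 2) ≠ 0 := (Real.rpow_pos_of_pos h0 _).ne'
            field_simp
        _ ≤ _ := by linarith
  obtain ⟨i1, e1⟩ := integrableOn_and_integral_Icc_inv hM hM1
  obtain ⟨i2, e2⟩ := integrableOn_and_integral_Ioo_rpow (σ := s / 2) hM (by linarith)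
  have hpow : ∀ r : ℝ, 0 < r → r ^ (n - 1) * (r ^ n)⁻¹ = r⁻¹ := by
    intro r hr
    obtain ⟨m, rfl⟩ := Nat.exists_eq_succ_of_ne_zero hn.ne'
    simp only [Nat.succ_eq_add_one, Nat.add_sub_cancel, pow_succ]
    field_simp
  have I1 := lintegral_ofReal_radial hn a hf₁ (i1.const_mul (M ^ s * Λ ^ β)) (fun r hr => by
    simp only [f₁]
    by_cases h : r ∈ Icc M 1
    · simp only [indicator_of_mem h]
      rw [mul_left_comm, hpow r hr]
    · simp only [indicator_of_notMem h, mul_zero])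
  have I2 := lintegral_ofReal_radial hn a hf₂ (i2.const_mul (2 * A * Λ ^ β * M ^ (s / 2)))
    (fun r hr => by
      simp only [f₂]
      by_cases h : r ∈ Ioo 0 M
      · simp only [indicator_of_mem h]
        rw [mul_left_comm, ← mul_assoc (r ^ (n - 1)), hpow r hr, Real.rpow_sub hr, Real.rpow_one]
        ring
      · simp only [indicator_of_notMem h, mul_zero])
  rw [integral_const_mul, e1, ← hV] at I1
  rw [integral_const_mul, e2, ← hV] at I2
  have hmeas : Measurable f₁ :=
    measurable_const.mul
      ((by fun_prop : Measurable fun r : ℝ => (r ^ n)⁻¹).indicator measurableSet_Icc)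
  calc _ ≤ ∫⁻ z in Metric.closedBall a 1,
        (ENNReal.ofReal (f₁ (dist a z)) + ENNReal.ofReal (f₂ (dist a z))) := by
        refine setLIntegral_mono' Metric.isClosed_closedBall.measurableSet fun z hz => ?_
        rw [← ENNReal.ofReal_add (hf₁ _) (hf₂ _)]
        refine ENNReal.ofReal_le_ofReal (hpt _ dist_nonneg ?_)
        rw [dist_comm]; exact hz
    _ ≤ ∫⁻ z, (ENNReal.ofReal (f₁ (dist a z)) + ENNReal.ofReal (f₂ (dist a z))) :=
        setLIntegral_le_lintegral _ _
    _ = ENNReal.ofReal (n * V * (M ^ s * Λ ^ β * Real.log (1 / M)) +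
          n * V * (2 * A * Λ ^ β * M ^ (s / 2) * (M ^ (s / 2) / (s / 2)))) := by
        have hmeas' : Measurable fun z : EuclideanSpace ℝ (Fin n) =>
            ENNReal.ofReal (f₁ (dist a z)) :=
          (hmeas.comp (by fun_prop : Measurable fun z => dist a z)).ennreal_ofReal
        rw [lintegral_add_left hmeas', I1, I2,
          ENNReal.ofReal_add (by positivity) (by positivity)]
    _ ≤ _ := by
        refine ENNReal.ofReal_le_ofReal ?_
        have h1 : M ^ (s / 2) * M ^ (s / 2) = M ^ s := by
          rw [← Real.rpow_add hM]; congr 1; ring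
        have h2 : Λ ^ (1 + β) = Λ * Λ ^ β := by rw [Real.rpow_add hΛ0, Real.rpow_one]
        have h3 : 0 ≤ M ^ s * (Λ * Λ ^ β) := by positivity
        have h4 : 0 ≤ n * V * (M ^ s * Λ ^ β) := by positivity
        have h5 : 0 ≤ n * V * (M ^ s * Λ ^ β) * (4 * A / s) := by positivity
        calc _ = n * V * (M ^ s * Λ ^ β) * Real.log (1 / M) +
              n * V * (M ^ s * Λ ^ β) * (4 * A / s) := by
              rw [← h1]; field_simp; ring
          _ ≤ n * V * (M ^ s * Λ ^ β) * Λ + n * V * (M ^ s * Λ ^ β) * (4 * A / s) * Λ := by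
              refine add_le_add (mul_le_mul_of_nonneg_left (by linarith) h4) ?_
              exact le_mul_of_one_le_right h5 hΛ1
          _ = n * V * (1 + 4 * A / s) * (M ^ s * (Λ * Λ ^ β)) := by ring
          _ ≤ _ := by rw [h2]; nlinarith

/-! ### Summation of the potential estimates against a Frostman measure -/

/-- Integration of the potential estimates against the discrete measure `∑ i, w i δ_{x i}`,
and Hölder's inequality with exponents `n` and `n / (n - 1)`. -/
theorem half_mass_le_of_potential {n : ℕ} (hn : 2 ≤ n) {Ω : Set (EuclideanSpace ℝ (Fin n))}
    (hΩ : IsOpen Ω) {ι : Type*} [Fintype ι] {x : ι → EuclideanSpace ℝ (Fin n)} {w : ι → ℝ}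
    (hx : ∀ i, x i ∈ frontier Ω) (hw : ∀ i, 0 ≤ w i) {A δ : ℝ} (hA : 1 ≤ A) (hδ : 0 < δ)
    (hgrowth : ∀ z r, δ ≤ r → ∑ i, (Metric.closedBall z r).indicator (fun _ => w i) (x i) ≤ r)
    {g : EuclideanSpace ℝ (Fin n) → EuclideanSpace ℝ (Fin n)}
    (hg : AEStronglyMeasurable g (volume.restrict Ω)) {V : EuclideanSpace ℝ (Fin n) → ℝ≥0∞}
    (hV : AEMeasurable V (volume.restrict Ω)) (hV0 : ∀ z, V z ≠ 0)
    (hVtop : ∀ᵐ z ∂volume.restrict Ω, V z ≠ ⊤) {C J : ℝ≥0∞}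
    (hpot : ∀ i, 2⁻¹ ≤ C * ∫⁻ z in Ω, (nontangentialRegion Ω A δ (x i)).indicator (fun z =>
        ‖g z‖ₑ * ENNReal.ofReal (Metric.infDist z (frontier Ω) *
          (Metric.infDist z (frontier Ω) ^ n)⁻¹)) z)
    (hJ : ∀ i, ∫⁻ z in Ω, ENNReal.ofReal ((dist (x i) z ^ n)⁻¹ *
      min (∑ i, w i) (A * dist (x i) z) ^ (1 / ((n : ℝ) - 1))) * V z ^ (1 / ((n : ℝ) - 1)) ≤ J) :
    ENNReal.ofReal (∑ i, w i) * 2⁻¹ ≤ C * ((∫⁻ z in Ω, ‖g z‖ₑ ^ n * (V z)⁻¹) ^ (1 / (n : ℝ)) *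
      (ENNReal.ofReal (A ^ n * ∑ i, w i) * J) ^ (((n : ℝ) - 1) / n)) := by
  have hn1 : (1 : ℝ) < n := by exact_mod_cast hn
  have hn0 : (0 : ℝ) < n := by linarith
  have hn2 : (0 : ℝ) < n - 1 := by linarith
  set s : ℝ := 1 / ((n : ℝ) - 1) with hs
  have hs0 : 0 < s := by positivity
  set M := ∑ i, w i with hM
  set d : EuclideanSpace ℝ (Fin n) → ℝ := fun z => Metric.infDist z (frontier Ω) with hd
  have hdc : Continuous d := Metric.continuous_infDist_pt _
  have hd0 : ∀ z, 0 ≤ d z := fun z => Metric.infDist_nonneg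
  let R : ι → Set (EuclideanSpace ℝ (Fin n)) := fun i => nontangentialRegion Ω A δ (x i)
  have hR : ∀ i, MeasurableSet (R i) := fun i => measurableSet_nontangentialRegion Ω A δ (x i)
  let m : EuclideanSpace ℝ (Fin n) → ℝ := fun z => ∑ i, (R i).indicator (fun _ => w i) z
  have hmm : Measurable m :=
    Finset.measurable_sum _ fun i _ => measurable_const.indicator (hR i)
  have hm0 : ∀ z, 0 ≤ m z := fun z =>
    Finset.sum_nonneg fun i _ => indicator_nonneg (fun _ _ => hw i) z
  have hmM : ∀ z, m z ≤ M := fun z =>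
    Finset.sum_le_sum fun i _ => indicator_le_self' (fun _ _ => hw i) z
  have hmd : ∀ z, δ ≤ A * d z → m z ≤ A * d z := by
    intro z hz
    refine le_trans (Finset.sum_le_sum fun i _ => ?_) (hgrowth z (A * d z) hz)
    by_cases h : z ∈ R i
    · rw [indicator_of_mem h, indicator_of_mem (show x i ∈ Metric.closedBall z (A * d z) from h.1)]
    · rw [indicator_of_notMem h]
      exact indicator_nonneg (fun _ _ => hw i) _
  -- Summing the potential estimates.
  have hsum : ENNReal.ofReal M * 2⁻¹ ≤
      C * ∫⁻ z in Ω, ‖g z‖ₑ * ENNReal.ofReal (d z * (d z ^ n)⁻¹ * m z) := by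
    have hint : ∀ i, AEMeasurable (fun z => ENNReal.ofReal (w i) * (R i).indicator (fun z =>
        ‖g z‖ₑ * ENNReal.ofReal (d z * (d z ^ n)⁻¹)) z) (volume.restrict Ω) := fun i => by
      refine AEMeasurable.const_mul ((hg.enorm.mul ?_).indicator (hR i)) _
      exact (hdc.measurable.mul (hdc.measurable.pow_const n).inv).ennreal_ofReal.aemeasurable
    calc ENNReal.ofReal M * 2⁻¹ = ∑ i, ENNReal.ofReal (w i) * 2⁻¹ := by
          rw [hM, ENNReal.ofReal_sum_of_nonneg fun i _ => hw i, Finset.sum_mul]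
      _ ≤ ∑ i, ENNReal.ofReal (w i) * (C * ∫⁻ z in Ω, (R i).indicator (fun z =>
          ‖g z‖ₑ * ENNReal.ofReal (d z * (d z ^ n)⁻¹)) z) :=
          Finset.sum_le_sum fun i _ => mul_le_mul_right (hpot i) _
      _ = C * ∫⁻ z in Ω, ∑ i, ENNReal.ofReal (w i) * (R i).indicator (fun z =>
          ‖g z‖ₑ * ENNReal.ofReal (d z * (d z ^ n)⁻¹)) z := by
          rw [lintegral_finsetSum' _ fun i _ => hint i, Finset.mul_sum]
          refine Finset.sum_congr rfl fun i _ => ?_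
          rw [lintegral_const_mul' _ _ ENNReal.ofReal_ne_top, mul_left_comm]
      _ = _ := by
          congr 1
          refine lintegral_congr fun z => ?_
          have h1 : 0 ≤ d z * (d z ^ n)⁻¹ :=
            mul_nonneg (hd0 z) (inv_nonneg.2 (pow_nonneg (hd0 z) _))
          rw [ENNReal.ofReal_mul h1, ENNReal.ofReal_sum_of_nonneg fun i _ =>
            indicator_nonneg (fun _ _ => hw i) z, ← mul_assoc, Finset.mul_sum]
          refine Finset.sum_congr rfl fun i _ => ?_
          by_cases h : z ∈ R i
          · simp only [indicator_of_mem h]; rw [mul_comm]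
          · simp only [indicator_of_notMem h]; simp
  -- Hölder's inequality.
  set q : ℝ := n / (n - 1) with hq
  have hpq : (n : ℝ).HolderConjugate q := (Real.holderConjugate_iff_eq_conjExponent hn1).2 rfl
  have hq0 : 0 < q := by positivity
  let f : EuclideanSpace ℝ (Fin n) → ℝ≥0∞ := fun z => ‖g z‖ₑ * (V z)⁻¹ ^ (1 / (n : ℝ))
  let k : EuclideanSpace ℝ (Fin n) → ℝ≥0∞ := fun z =>
    ENNReal.ofReal (d z * (d z ^ n)⁻¹ * m z) * V z ^ (1 / (n : ℝ))
  have hf : AEMeasurable f (volume.restrict Ω) := hg.enorm.mul (hV.inv.pow_const _)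
  have hk : AEMeasurable k (volume.restrict Ω) :=
    ((hdc.measurable.mul (hdc.measurable.pow_const n).inv).mul hmm).ennreal_ofReal.aemeasurable.mul
      (hV.pow_const _)
  have hfk : ∫⁻ z in Ω, ‖g z‖ₑ * ENNReal.ofReal (d z * (d z ^ n)⁻¹ * m z)
      = ∫⁻ z in Ω, (f * k) z := by
    refine lintegral_congr_ae ?_
    filter_upwards [hVtop] with z hz
    have h1 : (V z)⁻¹ ^ (1 / (n : ℝ)) * V z ^ (1 / (n : ℝ)) = 1 := by
      rw [ENNReal.inv_rpow]
      refine ENNReal.inv_mul_cancel ?_ (ENNReal.rpow_ne_top_of_nonneg (by positivity) hz)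
      simp [ENNReal.rpow_eq_zero_iff, hV0 z, hz]
    simp only [Pi.mul_apply, f, k]
    rw [mul_mul_mul_comm, h1, mul_one]
  have hfn : ∫⁻ z in Ω, f z ^ (n : ℝ) = ∫⁻ z in Ω, ‖g z‖ₑ ^ n * (V z)⁻¹ := by
    refine lintegral_congr fun z => ?_
    simp only [f]
    rw [ENNReal.mul_rpow_of_nonneg _ _ hn0.le, ← ENNReal.rpow_mul, one_div_mul_cancel hn0.ne',
      ENNReal.rpow_one, ENNReal.rpow_natCast]
  have hkq : ∫⁻ z in Ω, k z ^ q ≤ ENNReal.ofReal (A ^ n * M) * J := by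
    have hqs : q = 1 + s := by rw [hq, hs]; field_simp; ring
    have hqn : 1 / (n : ℝ) * q = s := by rw [hq, hs]; field_simp
    have hpt : ∀ z ∈ Ω, k z ^ q ≤ ∑ i, ENNReal.ofReal (A ^ n * w i) *
        (ENNReal.ofReal ((dist (x i) z ^ n)⁻¹ * min M (A * dist (x i) z) ^ s) * V z ^ s) := by
      intro z hz
      have hdist : ∀ i, d z ≤ dist (x i) z := fun i => by
        rw [dist_comm]; exact Metric.infDist_le_dist_of_mem (hx i)
      have h1 : 0 ≤ d z * (d z ^ n)⁻¹ := mul_nonneg (hd0 z) (inv_nonneg.2 (pow_nonneg (hd0 z) _))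
      have h2 : (d z * (d z ^ n)⁻¹) ^ q = (d z ^ n)⁻¹ := by
        rcases (hd0 z).eq_or_lt with h0 | h0
        · rw [← h0, zero_mul, Real.zero_rpow hq0.ne', zero_pow (by omega), inv_zero]
        · rw [← Real.rpow_natCast, ← Real.rpow_neg h0.le]
          nth_rewrite 1 [← Real.rpow_one (d z)]
          rw [← Real.rpow_add h0, ← Real.rpow_mul h0.le]
          congr 1
          rw [hq]; field_simp; ring
      have h3 : m z ^ q = m z ^ s * m z := by
        rw [hqs, Real.rpow_add_of_nonneg (hm0 z) one_pos.le hs0.le, Real.rpow_one, mul_comm]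
      have h4 : k z ^ q = ENNReal.ofReal ((d z ^ n)⁻¹ * m z ^ s * m z) * V z ^ s := by
        simp only [k]
        rw [ENNReal.mul_rpow_of_nonneg _ _ hq0.le, ← ENNReal.rpow_mul, hqn,
          ENNReal.ofReal_rpow_of_nonneg (mul_nonneg h1 (hm0 z)) hq0.le, Real.mul_rpow h1 (hm0 z),
          h2, h3, mul_assoc ((d z ^ n)⁻¹)]
      have h5 : (d z ^ n)⁻¹ * m z ^ s * m z ≤
          ∑ i, A ^ n * w i * ((dist (x i) z ^ n)⁻¹ * min M (A * dist (x i) z) ^ s) := by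
        simp only [m]
        rw [Finset.mul_sum]
        refine Finset.sum_le_sum fun i _ => ?_
        have hwi := hw i
        have hmin : 0 ≤ min M (A * dist (x i) z) :=
          le_min (Finset.sum_nonneg fun i _ => hw i) (by positivity)
        by_cases h : z ∈ R i
        · rw [indicator_of_mem h]
          have h6 : dist (x i) z ≤ A * d z := h.1
          have h7 : δ ≤ A * d z := h.2
          have h8 : 0 < d z := by
            by_contra hcon
            rw [le_antisymm (not_lt.1 hcon) (hd0 z)] at h7
            linarith
          have h9 : (d z ^ n)⁻¹ ≤ A ^ n * (dist (x i) z ^ n)⁻¹ := by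
            have h10 : 0 < dist (x i) z := h8.trans_le (hdist i)
            rw [← div_eq_mul_inv, inv_le_comm₀ (by positivity) (by positivity), inv_div,
              div_le_iff₀ (by positivity), ← mul_pow, mul_comm (d z)]
            exact pow_le_pow_left₀ h10.le h6 n
          have h10 : m z ^ s ≤ min M (A * dist (x i) z) ^ s := by
            refine Real.rpow_le_rpow (hm0 z) (le_min (hmM z) ((hmd z h7).trans ?_)) hs0.le
            exact mul_le_mul_of_nonneg_left (hdist i) (by linarith)
          calc _ ≤ A ^ n * (dist (x i) z ^ n)⁻¹ * min M (A * dist (x i) z) ^ s * w i := by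
                have := Real.rpow_nonneg (hm0 z) s
                exact mul_le_mul_of_nonneg_right (mul_le_mul h9 h10 this (by positivity)) hwi
            _ = _ := by ring
        · rw [indicator_of_notMem h, mul_zero]
          positivity
      rw [h4]
      refine (mul_le_mul_left (ENNReal.ofReal_le_ofReal h5) _).trans (le_of_eq ?_)
      have hmin : ∀ i, 0 ≤ (dist (x i) z ^ n)⁻¹ * min M (A * dist (x i) z) ^ s := fun i =>
        mul_nonneg (by positivity) (Real.rpow_nonneg
          (le_min (Finset.sum_nonneg fun i _ => hw i) (by positivity)) _)
      rw [ENNReal.ofReal_sum_of_nonneg fun i _ => mul_nonneg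
        (mul_nonneg (by positivity) (hw i)) (hmin i), Finset.sum_mul]
      refine Finset.sum_congr rfl fun i _ => ?_
      rw [ENNReal.ofReal_mul (mul_nonneg (by positivity) (hw i)), mul_assoc]
    calc ∫⁻ z in Ω, k z ^ q ≤ ∫⁻ z in Ω, ∑ i, ENNReal.ofReal (A ^ n * w i) *
        (ENNReal.ofReal ((dist (x i) z ^ n)⁻¹ * min M (A * dist (x i) z) ^ s) * V z ^ s) :=
          setLIntegral_mono' hΩ.measurableSet hpt
      _ = ∑ i, ENNReal.ofReal (A ^ n * w i) * ∫⁻ z in Ω,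
        (ENNReal.ofReal ((dist (x i) z ^ n)⁻¹ * min M (A * dist (x i) z) ^ s) * V z ^ s) := by
          rw [lintegral_finsetSum']
          · exact Finset.sum_congr rfl fun i _ => lintegral_const_mul' _ _ ENNReal.ofReal_ne_top
          · refine fun i _ => AEMeasurable.const_mul (AEMeasurable.mul ?_ (hV.pow_const _)) _
            exact Measurable.aemeasurable (by fun_prop)
      _ ≤ ∑ i, ENNReal.ofReal (A ^ n * w i) * J :=
          Finset.sum_le_sum fun i _ => mul_le_mul_right (hJ i) _
      _ = ENNReal.ofReal (A ^ n * M) * J := by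
          rw [← Finset.sum_mul, hM, Finset.mul_sum,
            ENNReal.ofReal_sum_of_nonneg fun i _ => mul_nonneg (by positivity) (hw i)]
  refine hsum.trans (mul_le_mul_right ?_ _)
  rw [hfk]
  refine (ENNReal.lintegral_mul_le_Lp_mul_Lq _ hpq hf hk).trans ?_
  rw [hfn, show ((n : ℝ) - 1) / n = 1 / q by rw [hq, one_div_div]]
  gcongr

/-! ### The capacity estimate for general weights -/

/-- A compact set of diameter at most `1` lies in a ball of radius less than `1`, centred at the
midpoint of a diametral pair. -/
theorem hausdorffContentOne_le_of_dist_le_one {n : ℕ} {E : Set (EuclideanSpace ℝ (Fin n))}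
    (hE : IsCompact E) (h : ∀ x ∈ E, ∀ y ∈ E, dist x y ≤ 1) :
    hausdorffContentOne E ≤ ENNReal.ofReal (9 / 10) := by
  obtain ⟨m, hm⟩ : ∃ m : EuclideanSpace ℝ (Fin n), E ⊆ Metric.ball m (9 / 10) := by
    rcases E.eq_empty_or_nonempty with rfl | hne
    · exact ⟨0, empty_subset _⟩
    obtain ⟨⟨a, b⟩, hab, hmax⟩ := (hE.prod hE).exists_isMaxOn (hne.prod hne)
      (f := fun p => dist p.1 p.2) (by fun_prop)
    obtain ⟨ha, hb⟩ := mem_prod.1 hab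
    rw [isMaxOn_iff] at hmax
    simp only at ha hb hmax
    refine ⟨(1 / 2 : ℝ) • (a + b), fun z hz => ?_⟩
    have h1 : dist z a ≤ dist a b := hmax (z, a) (mk_mem_prod hz ha)
    have h2 : dist z b ≤ dist a b := hmax (z, b) (mk_mem_prod hz hb)
    have h3 : dist a b ≤ 1 := h a ha b hb
    have h4 := parallelogram_law_with_norm ℝ (z - a) (z - b)
    have h5 : z - a + (z - b) = (2 : ℝ) • (z - (1 / 2 : ℝ) • (a + b)) := by
      rw [smul_sub, smul_smul, two_smul]; norm_num; abel
    have h6 : z - a - (z - b) = b - a := by abel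
    rw [h5, h6, norm_smul, ← dist_eq_norm, ← dist_eq_norm, ← dist_eq_norm, ← dist_eq_norm,
      dist_comm b a, Real.norm_of_nonneg two_pos.le] at h4
    rw [Metric.mem_ball]
    have h7 : dist z ((1 / 2 : ℝ) • (a + b)) * dist z ((1 / 2 : ℝ) • (a + b)) ≤ 3 / 4 := by
      nlinarith [dist_nonneg (x := z) (y := a), dist_nonneg (x := z) (y := b),
        dist_nonneg (x := a) (y := b)]
    by_contra hcon
    nlinarith [not_lt.1 hcon]
  refine (hausdorffContentOne_le_sum (Finset.univ : Finset Unit) (fun _ => m)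
    (fun _ => (9 / 10 : ℝ).toNNReal) E ?_).trans ?_
  · refine hm.trans (subset_iUnion₂_of_subset () (Finset.mem_univ _) ?_)
    rw [Real.coe_toNNReal _ (by norm_num)]
  · simp [ENNReal.ofReal]

/-- The admissible growth of a weight for the capacity estimate: `V ^ (1 / (n - 1))` is at most a
power of the logarithm of the distance to the boundary point `a`, up to an error that is integrable
with the singular factor `|z - a| ^ (-n)`. -/
def HasLogGrowth {n : ℕ} (Ω : Set (EuclideanSpace ℝ (Fin n)))
    (V : EuclideanSpace ℝ (Fin n) → ℝ≥0∞) (β κ L : ℝ) : Prop :=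
  ∃ G : EuclideanSpace ℝ (Fin n) → ℝ≥0∞, ∫⁻ z in Ω, G z ≤ ENNReal.ofReal L ∧
    ∀ a ∈ frontier Ω, ∀ z ∈ Ω, dist a z ≤ 1 → V z ^ (1 / ((n : ℝ) - 1)) ≤
      ENNReal.ofReal (κ * (1 + Real.log (1 / dist a z)) ^ β) + G z * ENNReal.ofReal (dist a z ^ n)

theorem HasLogGrowth.exists_lintegral_le {n : ℕ} (hn : 2 ≤ n) {A β κ L : ℝ} (hA : 1 ≤ A)
    (hβ : 0 ≤ β) (hβn : β ≤ 1 / ((n : ℝ) - 1)) (hκ : 0 ≤ κ) (hL : 0 ≤ L) :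
    ∃ K : ℝ, 0 < K ∧ ∀ (Ω : Set (EuclideanSpace ℝ (Fin n))) (V : EuclideanSpace ℝ (Fin n) → ℝ≥0∞),
      IsOpen Ω → HasLogGrowth Ω V β κ L → ∀ a ∈ frontier Ω, Ω ⊆ Metric.closedBall a 1 →
      ∀ M : ℝ, 0 < M → M ≤ 1 →
        ∫⁻ z in Ω, ENNReal.ofReal ((dist a z ^ n)⁻¹ *
          min M (A * dist a z) ^ (1 / ((n : ℝ) - 1))) * V z ^ (1 / ((n : ℝ) - 1)) ≤
        ENNReal.ofReal (K * (M ^ (1 / ((n : ℝ) - 1)) * (1 + Real.log (1 / M)) ^ (1 + β))) := by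
  have hn1 : (2 : ℝ) ≤ n := by exact_mod_cast hn
  have hn2 : (0 : ℝ) < n - 1 := by linarith
  set s : ℝ := 1 / ((n : ℝ) - 1) with hs
  have hs0 : 0 < s := by positivity
  have hs1 : s ≤ 1 := by rw [hs, div_le_one hn2]; linarith
  obtain ⟨K, hK, hrad⟩ := exists_lintegral_log_le (n := n) (by omega) hA hs0 hs1 hβ hβn
  refine ⟨κ * K + L + 1, by positivity, fun Ω V hΩ hV a ha hΩa M hM hM1 => ?_⟩
  obtain ⟨G, hG, hVG⟩ := hV
  have hΛ : 1 ≤ (1 + Real.log (1 / M)) := by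
    have := Real.log_nonneg ((one_le_div hM).2 hM1)
    linarith
  have hpt : ∀ z ∈ Ω, ENNReal.ofReal ((dist a z ^ n)⁻¹ * min M (A * dist a z) ^ s) * V z ^ s ≤
      ENNReal.ofReal κ * ENNReal.ofReal ((dist a z ^ n)⁻¹ * min M (A * dist a z) ^ s *
        (1 + Real.log (1 / dist a z)) ^ β) + ENNReal.ofReal (M ^ s) * G z := by
    intro z hz
    have hz1 : dist a z ≤ 1 := by rw [dist_comm]; exact hΩa hz
    have hmin : 0 ≤ min M (A * dist a z) := le_min hM.le (by positivity)
    refine (mul_le_mul_right (hVG a ha z hz hz1) _).trans ?_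
    rw [mul_add]
    refine add_le_add (le_of_eq ?_) ?_
    · rw [← ENNReal.ofReal_mul (by positivity), ← ENNReal.ofReal_mul hκ]
      congr 1; ring
    · rw [mul_left_comm, ← ENNReal.ofReal_mul (by positivity), mul_comm (G z)]
      refine mul_le_mul_left (ENNReal.ofReal_le_ofReal ?_) _
      have h1 : min M (A * dist a z) ^ s ≤ M ^ s := Real.rpow_le_rpow hmin (min_le_left _ _) hs0.le
      have h2 : (dist a z ^ n)⁻¹ * dist a z ^ n ≤ 1 := inv_mul_le_one
      calc (dist a z ^ n)⁻¹ * min M (A * dist a z) ^ s * dist a z ^ n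
          = ((dist a z ^ n)⁻¹ * dist a z ^ n) * min M (A * dist a z) ^ s := by ring
        _ ≤ 1 * M ^ s := by gcongr
        _ = M ^ s := one_mul _
  calc _ ≤ ∫⁻ z in Ω, (ENNReal.ofReal κ * ENNReal.ofReal ((dist a z ^ n)⁻¹ *
        min M (A * dist a z) ^ s * (1 + Real.log (1 / dist a z)) ^ β) +
        ENNReal.ofReal (M ^ s) * G z) := setLIntegral_mono' hΩ.measurableSet hpt
    _ = ENNReal.ofReal κ * (∫⁻ z in Ω, ENNReal.ofReal ((dist a z ^ n)⁻¹ *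
        min M (A * dist a z) ^ s * (1 + Real.log (1 / dist a z)) ^ β)) +
        ENNReal.ofReal (M ^ s) * ∫⁻ z in Ω, G z := by
        rw [lintegral_add_left (by fun_prop), lintegral_const_mul' _ _ ENNReal.ofReal_ne_top,
          lintegral_const_mul' _ _ ENNReal.ofReal_ne_top]
    _ ≤ ENNReal.ofReal κ * ENNReal.ofReal (K * (M ^ s * (1 + Real.log (1 / M)) ^ (1 + β))) +
        ENNReal.ofReal (M ^ s) * ENNReal.ofReal L :=
        add_le_add (mul_le_mul_right ((lintegral_mono_set hΩa).trans (hrad M hM hM1 a)) _)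
          (mul_le_mul_right hG _)
    _ ≤ _ := by
        have h1 : 1 ≤ (1 + Real.log (1 / M)) ^ (1 + β) := Real.one_le_rpow hΛ (by linarith)
        have h2 : 0 < M ^ s := by positivity
        rw [← ENNReal.ofReal_mul hκ, ← ENNReal.ofReal_mul h2.le,
          ← ENNReal.ofReal_add (by positivity) (by positivity)]
        refine ENNReal.ofReal_le_ofReal ?_
        have h3 : M ^ s * L ≤ L * (M ^ s * (1 + Real.log (1 / M)) ^ (1 + β)) := by
          rw [mul_comm]
          exact mul_le_mul_of_nonneg_left (le_mul_of_one_le_right h2.le h1) hL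
        have h4 : 0 ≤ M ^ s * (1 + Real.log (1 / M)) ^ (1 + β) := by positivity
        linarith

/-- Solving the inequality obtained from Hölder's inequality for the energy `e`; the powers of the
mass `M` cancel. -/
theorem le_energy_of_half_mass_le {n : ℕ} (hn : 2 ≤ n) {C D M Λ β : ℝ} (hC : 0 < C) (hD : 0 < D)
    (hM : 0 < M) (hΛ : 0 < Λ) {e : ℝ≥0∞}
    (h : ENNReal.ofReal M * 2⁻¹ ≤ ENNReal.ofReal C * (e ^ (1 / (n : ℝ)) *
      (ENNReal.ofReal (D * (M * (M ^ (1 / ((n : ℝ) - 1)) * Λ ^ (1 + β))))) ^ (((n : ℝ) - 1) / n))) :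
    ENNReal.ofReal ((2 * C * D ^ (((n : ℝ) - 1) / n)) ^ (-(n : ℝ)) *
      Λ ^ (-((1 + β) * ((n : ℝ) - 1))))
      ≤ e := by
  rcases eq_or_ne e ⊤ with rfl | he
  · exact le_top
  have hn1 : (2 : ℝ) ≤ n := by exact_mod_cast hn
  have hn0 : (0 : ℝ) < n := by linarith
  have hn2 : (0 : ℝ) < n - 1 := by linarith
  obtain ⟨e', rfl⟩ : ∃ e' : ℝ≥0, e = e' := ⟨e.toNNReal, (ENNReal.coe_toNNReal he).symm⟩
  rw [← ENNReal.ofReal_coe_nnreal] at h ⊢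
  have he0 : (0 : ℝ) ≤ e' := e'.2
  set D' := D ^ (((n : ℝ) - 1) / n) with hD'
  have hD'0 : 0 < D' := by positivity
  set Y := Λ ^ ((1 + β) * (((n : ℝ) - 1) / n)) with hY
  have hY0 : 0 < Y := by positivity
  have h1 : (D * (M * (M ^ (1 / ((n : ℝ) - 1)) * Λ ^ (1 + β)))) ^ (((n : ℝ) - 1) / n)
      = D' * (M * Y) := by
    rw [← mul_assoc M, Real.mul_rpow hD.le (by positivity),
      Real.mul_rpow (x := M * _) (by positivity) (by positivity), ← Real.rpow_mul hΛ.le]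
    congr 2
    have h2 : M * M ^ (1 / ((n : ℝ) - 1)) = M ^ ((n : ℝ) / (n - 1)) := by
      nth_rewrite 1 [← Real.rpow_one M]
      rw [← Real.rpow_add hM]
      congr 1; field_simp; ring
    rw [h2, ← Real.rpow_mul hM.le, div_mul_div_cancel₀ hn2.ne', div_self hn0.ne', Real.rpow_one]
  rw [ENNReal.ofReal_rpow_of_nonneg he0 (by positivity),
    ENNReal.ofReal_rpow_of_nonneg (by positivity) (by positivity), h1,
    ← ENNReal.ofReal_mul (by positivity),
    ← ENNReal.ofReal_mul (by positivity), show (2⁻¹ : ℝ≥0∞) = ENNReal.ofReal 2⁻¹ by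
      rw [ENNReal.ofReal_inv_of_pos two_pos]; simp,
    ← ENNReal.ofReal_mul (by positivity), ENNReal.ofReal_le_ofReal_iff (by positivity)] at h
  refine ENNReal.ofReal_le_ofReal ?_
  have h2 : 1 ≤ 2 * C * D' * Y * (e' : ℝ) ^ (1 / (n : ℝ)) := by
    refine le_of_mul_le_mul_left ?_ hM
    linarith
  have h3 : 1 ≤ (2 * C * D') ^ (n : ℝ) * Λ ^ ((1 + β) * ((n : ℝ) - 1)) * e' := by
    have h4 := Real.one_le_rpow h2 hn0.le
    rw [Real.mul_rpow (by positivity) (by positivity),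
      Real.mul_rpow (by positivity) (by positivity), hY, ← Real.rpow_mul hΛ.le,
      ← Real.rpow_mul he0, one_div_mul_cancel hn0.ne', Real.rpow_one] at h4
    convert h4 using 4
    field_simp
  rw [Real.rpow_neg (by positivity), Real.rpow_neg hΛ.le, ← mul_inv]
  rw [inv_le_iff_one_le_mul₀' (by positivity)]
  exact h3

theorem exists_forall_le_half_of_continuousOn {X : Type*} [PseudoMetricSpace X] {K E : Set X}
    {u : X → ℝ} (hK : IsCompact K) (hu : ContinuousOn u K) (hEK : E ⊆ K) (hE : ∀ x ∈ E, u x ≤ 0) :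
    ∃ δ > 0, ∀ a ∈ E, ∀ z ∈ K, dist z a < δ → u z ≤ 1 / 2 := by
  obtain ⟨δ, hδ, h⟩ := Metric.uniformContinuousOn_iff.1
    (hK.uniformContinuousOn_of_continuous hu) (1 / 2) (by norm_num)
  refine ⟨δ, hδ, fun a ha z hz hza => ?_⟩
  have h1 := h z hz a (hEK ha) hza
  rw [Real.dist_eq] at h1
  linarith [(abs_lt.1 h1).2, hE a ha]

/-- The capacity estimate in a John domain for a weight of logarithmic growth with exponent `β`. -/
theorem exists_energy_lower_bound {n : ℕ} (hn : 2 ≤ n) {c₀ β κ L : ℝ} (hc₀ : 0 < c₀)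
    (hβ : 0 ≤ β) (hβn : β ≤ 1 / ((n : ℝ) - 1)) (hκ : 0 ≤ κ) (hL : 0 ≤ L) :
    ∃ C : ℝ≥0, 0 < C ∧
      ∀ (Ω : Set (EuclideanSpace ℝ (Fin n))) (x₀ : EuclideanSpace ℝ (Fin n))
        (W : Set (AxisCube n)) (Q : AxisCube n) (E : Set (EuclideanSpace ℝ (Fin n)))
        (V : EuclideanSpace ℝ (Fin n) → ℝ≥0∞) (u : EuclideanSpace ℝ (Fin n) → ℝ)
        (g : EuclideanSpace ℝ (Fin n) → EuclideanSpace ℝ (Fin n)),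
        IsJohnDomain c₀ Ω x₀ → Metric.diam Ω = 1 → IsWhitneyDecomposition Ω W → Q ∈ W →
        x₀ ∈ Q.carrier → IsCompact E → E ⊆ frontier Ω →
        AEMeasurable V (volume.restrict Ω) → (∀ z, V z ≠ 0) →
        (∀ᵐ z ∂volume.restrict Ω, V z ≠ ⊤) → HasLogGrowth Ω V β κ L →
        IsAdmissible E Q.carrier Ω u g →
        (C : ℝ≥0∞) * logInv (hausdorffContentOne E) ^ (-((1 + β) * ((n : ℝ) - 1)))
          ≤ ∫⁻ z in Ω, ‖g z‖ₑ ^ n * (V z)⁻¹ := by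
  have hn0 : 0 < n := by omega
  have hn1 : (2 : ℝ) ≤ n := by exact_mod_cast hn
  have hn2 : (0 : ℝ) < n - 1 := by linarith
  obtain ⟨φ, hφ⟩ := exists_isAveragingKernel n
  obtain ⟨K₀, hK₀⟩ := (hasCompactSupport_of_tsupport_subset hφ.tsupport_subset
    ).exists_bound_of_continuous hφ.contDiff.continuous
  have hK : ∀ y, φ y ≤ |K₀| + 1 := fun y => by
    linarith [le_abs_self K₀, (le_abs_self (φ y)).trans (hK₀ y)]
  set c : ℝ := n * (11 * c₀ + 2) with hc
  have hc1 : 1 ≤ c := by nlinarith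
  have hA : 1 ≤ 12 * c := by linarith
  obtain ⟨K₁, hK₁, hint⟩ := HasLogGrowth.exists_lintegral_le hn hA hβ hβn hκ hL
  set C₁ : ℝ := 2 * (|K₀| + 1) * (12 * c) ^ n * (4 * c + 1) with hC₁
  have hC₁0 : 0 < C₁ := by positivity
  set D : ℝ := (12 * c) ^ n * K₁ with hD
  have hD0 : 0 < D := by positivity
  set γ : ℝ := (1 + β) * ((n : ℝ) - 1) with hγ
  have hγ0 : 0 < γ := by positivity
  let C : ℝ := (2 * C₁ * D ^ (((n : ℝ) - 1) / n)) ^ (-(n : ℝ)) * 150 ^ (-γ)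
  have hC0 : 0 < C := by positivity
  refine ⟨C.toNNReal, Real.toNNReal_pos.2 hC0, ?_⟩
  intro Ω x₀ W Q E V u g hΩ hdiam hW hQ hx₀ hE hEF hV hV0 hVtop hVG hadm
  change ENNReal.ofReal C * _ ≤ _
  have hcl : IsCompact (closure Ω) := hΩ.isBounded.isCompact_closure
  have hdist : ∀ y ∈ closure Ω, ∀ z ∈ closure Ω, dist y z ≤ 1 := fun y hy z hz => by
    rw [← hdiam, ← Metric.diam_closure]
    exact Metric.dist_le_diam_of_mem hcl.isBounded hy hz
  have hEcl : E ⊆ closure Ω := hEF.trans frontier_subset_closure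
  -- If the content vanishes, then so does the left-hand side.
  set t := hausdorffContentOne E with ht
  rcases eq_or_ne t 0 with ht0 | ht0
  · have : logInv t = ⊤ := by rw [ht0]; simp [logInv]
    rw [this, ENNReal.top_rpow_of_neg (by linarith), mul_zero]
    exact zero_le
  have ht9 : t ≤ ENNReal.ofReal (9 / 10) :=
    hausdorffContentOne_le_of_dist_le_one hE fun y hy z hz => hdist y (hEcl hy) z (hEcl hz)
  obtain ⟨τ, hτ0, hτt⟩ : ∃ τ : ℝ, 0 < τ ∧ t = ENNReal.ofReal τ := by
    have : t ≠ ⊤ := ne_top_of_le_ne_top ENNReal.ofReal_ne_top ht9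
    exact ⟨t.toReal, ENNReal.toReal_pos ht0 this, (ENNReal.ofReal_toReal this).symm⟩
  have hτ9 : τ ≤ 9 / 10 := by
    rw [hτt] at ht9
    exact (ENNReal.ofReal_le_ofReal_iff (by norm_num)).1 ht9
  set T := Real.log (1 / τ) with hT
  have hT1 : 1 / 10 ≤ T := by
    have := Real.log_le_sub_one_of_pos hτ0
    have h1 : T = -Real.log τ := by rw [hT, one_div, Real.log_inv]
    linarith
  have hlogInv : logInv t = ENNReal.ofReal T := by
    rw [hτt, logInv, ← ENNReal.ofReal_inv_of_pos hτ0, ENNReal.log_ofReal_of_pos (inv_pos.2 hτ0),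
      EReal.real_coe_toENNReal, hT, one_div]
  -- The nonempty set `E` provides boundary points.
  have hEne : E.Nonempty := by
    rw [nonempty_iff_ne_empty]
    rintro rfl
    refine ht0 (le_antisymm ?_ zero_le)
    simpa using hausdorffContentOne_le_sum (∅ : Finset Unit)
      (fun _ => (0 : EuclideanSpace ℝ (Fin n)))
      (fun _ => 0) ∅ (empty_subset _)
  have hF : (frontier Ω).Nonempty := hEne.mono hEF
  have hΩa : ∀ a ∈ frontier Ω, Ω ⊆ Metric.closedBall a 1 := fun a ha z hz =>
    hdist z (subset_closure hz) a (frontier_subset_closure ha)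
  have hvol : volume Ω ≠ ⊤ := hΩ.isBounded.measure_lt_top.ne
  have : IsFiniteMeasure (volume.restrict Ω) := ⟨by simpa using hvol.lt_top⟩
  have hn1' : (1 : ℝ≥0∞) ≤ n := by exact_mod_cast hn0
  have hu : IntegrableOn u Ω := hadm.sobolev.memLp.integrable hn1'
  have hg : IntegrableOn g Ω := hadm.sobolev.memLp_gradient.integrable hn1'
  obtain ⟨δ₀, hδ₀, huδ⟩ := exists_forall_le_half_of_continuousOn hcl hadm.continuousOn hEcl
    hadm.le_zero
  set δ : ℝ := min (δ₀ / 4) (min Q.halfSide 1) with hδ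
  have hδ0 : 0 < δ := lt_min (by positivity) (lt_min Q.halfSide_pos one_pos)
  have hδ1 : δ ≤ δ₀ / 4 := min_le_left _ _
  have hδ2 : δ ≤ Q.halfSide := (min_le_right _ _).trans (min_le_left _ _)
  have hδ3 : δ ≤ 1 := (min_le_right _ _).trans (min_le_right _ _)
  have hpot : ∀ a ∈ E, 2⁻¹ ≤ ENNReal.ofReal C₁ *
      ∫⁻ z in Ω, (nontangentialRegion Ω (12 * c) δ a).indicator (fun z => ‖g z‖ₑ *
        ENNReal.ofReal (Metric.infDist z (frontier Ω) *
          (Metric.infDist z (frontier Ω) ^ n)⁻¹)) z := by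
    intro a ha
    obtain ⟨x, hx, hxa⟩ := Metric.mem_closure_iff.1 (hEcl ha) δ hδ0
    obtain ⟨l, η, hl, hη0, hηl, hηLip, hηΩ, hlc⟩ :=
      hΩ.exists_curve_to_cube hn0 hc₀ hW hQ hx₀ hF hx
    refine hadm.sobolev.one_half_le_potential hΩ.isOpen hvol hu hg hφ hK hc1 (hEF ha) hl hη0 hηl
      hηLip hηΩ hδ0 ?_ (by rwa [dist_comm]) (fun z hz hza => ?_) (fun z hz => ?_)
    · have := hW.two_mul_halfSide_le_infDist hn0 hQ hF Q.center_mem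
      linarith
    · exact huδ a ha z (subset_closure hz) (by linarith)
    · exact hadm.one_le z (Q.closedBall_subset (Metric.closedBall_subset_closedBall hlc hz))
  obtain ⟨ι, _, x, w, hxE, hw, hgrowth, hmass⟩ := exists_finite_frostman hE hδ0
  set M := ∑ i, w i with hM
  have hτM : τ ≤ 14 * M := by
    rw [← ht, hτt] at hmass
    by_contra hcon
    have h1 := (ENNReal.ofReal_lt_ofReal_iff hτ0).2 (not_le.1 hcon)
    exact absurd hmass (not_le.2 h1)
  have hM0 : 0 < M := by linarith
  have hM1 : M ≤ 1 := by
    obtain ⟨b, hb⟩ := hEne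
    have := hgrowth b 1 hδ3
    rwa [Finset.sum_congr rfl fun i _ => indicator_of_mem
      (show x i ∈ Metric.closedBall b 1 from hdist _ (hEcl (hxE i)) _ (hEcl hb)) _] at this
  set Λ := 1 + Real.log (1 / M) with hΛ
  have hΛ1 : 1 ≤ Λ := by
    have := Real.log_nonneg ((one_le_div hM0).2 hM1)
    linarith
  have hΛT : Λ ≤ 150 * T := by
    have h1 : Real.log (1 / M) ≤ Real.log 14 + T := by
      rw [hT, ← Real.log_mul (by norm_num) (by positivity)]
      refine Real.log_le_log (by positivity) ?_
      rw [mul_one_div, div_le_div_iff₀ hM0 hτ0]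
      linarith
    have h2 : Real.log 14 ≤ 13 := by
      have := Real.log_le_sub_one_of_pos (show (0 : ℝ) < 14 by norm_num)
      linarith
    linarith
  have hhalf := half_mass_le_of_potential hn hΩ.isOpen (fun i => hEF (hxE i)) hw hA hδ0 hgrowth
    hg.aestronglyMeasurable hV hV0 hVtop (fun i => hpot _ (hxE i))
    (fun i => hint Ω V hΩ.isOpen hVG _ (hEF (hxE i)) (hΩa _ (hEF (hxE i))) M hM0 hM1)
  rw [← hM, ← ENNReal.ofReal_mul (by positivity), show (12 * c) ^ n * M * (K₁ *
    (M ^ (1 / ((n : ℝ) - 1)) * Λ ^ (1 + β))) = D * (M * (M ^ (1 / ((n : ℝ) - 1)) * Λ ^ (1 + β))) by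
      rw [hD]; ring] at hhalf
  refine le_trans ?_ (le_energy_of_half_mass_le hn hC₁0 hD0 hM0 (by linarith) hhalf)
  rw [hlogInv, ENNReal.ofReal_rpow_of_pos (by linarith), ← ENNReal.ofReal_mul hC0.le]
  refine ENNReal.ofReal_le_ofReal ?_
  simp only [C]
  rw [mul_assoc, ← Real.mul_rpow (by norm_num) (by linarith)]
  refine mul_le_mul_of_nonneg_left ?_ (by positivity)
  exact Real.rpow_le_rpow_of_nonpos (by linarith) hΛT (by linarith)

/-! ### Constant weights and exponentially integrable weights -/

theorem hasLogGrowth_one {n : ℕ} (Ω : Set (EuclideanSpace ℝ (Fin n))) :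
    HasLogGrowth Ω (fun _ => 1) 0 1 0 :=
  ⟨0, by simp, fun a _ z _ _ => by simp⟩

theorem le_two_div_mul_exp {lam V : ℝ} (hlam : 0 < lam) : V ≤ 2 / lam * Real.exp (lam * V / 2) := by
  have h1 := Real.add_one_le_exp (lam * V / 2)
  rw [div_mul_eq_mul_div, le_div_iff₀ hlam]
  nlinarith

/-- Where `V` exceeds a large multiple of the logarithm, half of the exponent in `exp (lam * V)`
provides the factor `ρ ^ n`. -/
theorem rpow_le_log_add_exp {n : ℕ} {lam s V ρ : ℝ} (hlam : 0 < lam) (hs : 0 ≤ s) (hs1 : s ≤ 1)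
    (hV : 1 ≤ V) (hρ : 0 < ρ) (hρ1 : ρ ≤ 1) :
    V ^ s ≤ (2 * n / lam) ^ s * (1 + Real.log (1 / ρ)) ^ s +
      2 / lam * Real.exp (lam * V) * ρ ^ n := by
  have hℓ : 0 ≤ Real.log (1 / ρ) := Real.log_nonneg ((one_le_div hρ).2 hρ1)
  have hV0 : 0 ≤ V := by linarith
  rcases le_or_gt V (2 * n / lam * (1 + Real.log (1 / ρ))) with h | h
  · rw [← Real.mul_rpow (by positivity) (by positivity)]
    have h1 := Real.rpow_le_rpow hV0 h hs
    have h2 : 0 ≤ 2 / lam * Real.exp (lam * V) * ρ ^ n := by positivity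
    linarith
  · have h1 : V ^ s ≤ V := by simpa using Real.rpow_le_rpow_of_exponent_le hV hs1
    have h2 : Real.exp (lam * V / 2) ≤ Real.exp (lam * V) * ρ ^ n := by
      rw [← Real.exp_log (pow_pos hρ n), ← Real.exp_add, Real.exp_le_exp, Real.log_pow]
      rw [one_div, Real.log_inv, div_mul_eq_mul_div, div_lt_iff₀ hlam] at h
      have h3 : (0 : ℝ) ≤ n := Nat.cast_nonneg n
      nlinarith
    have h3 : 0 ≤ (2 * n / lam) ^ s * (1 + Real.log (1 / ρ)) ^ s := by positivity
    calc V ^ s ≤ 2 / lam * Real.exp (lam * V / 2) := h1.trans (le_two_div_mul_exp hlam)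
      _ ≤ 2 / lam * (Real.exp (lam * V) * ρ ^ n) := by gcongr
      _ ≤ _ := by linarith

theorem exp_mul_top {lam : ℝ} (hlam : 0 < lam) :
    EReal.exp ((lam : EReal) * ((⊤ : ℝ≥0∞) : EReal)) = ⊤ := by
  rw [EReal.coe_ennreal_top, EReal.coe_mul_top_of_pos hlam, EReal.exp_top]

theorem exp_mul_coe (lam : ℝ) (r : ℝ≥0) :
    EReal.exp ((lam : EReal) * (((r : ℝ≥0∞)) : EReal)) = ENNReal.ofReal (Real.exp (lam * r)) := by
  rw [EReal.coe_nnreal_eq_coe_real, ← EReal.coe_mul, EReal.exp_coe]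

theorem ae_ne_top_of_lintegral_exp {α : Type*} [MeasurableSpace α] {μ : Measure α} {v : α → ℝ≥0∞}
    {lam : ℝ} (hlam : 0 < lam) (hv : AEMeasurable v μ)
    (h : ∫⁻ x, EReal.exp ((lam : EReal) * (v x : EReal)) ∂μ ≠ ⊤) : ∀ᵐ x ∂μ, v x ≠ ⊤ := by
  have hle : ∀ x, v x ≤ ENNReal.ofReal (1 / lam) * EReal.exp ((lam : EReal) * (v x : EReal)) := by
    intro x
    rcases eq_or_ne (v x) ⊤ with hx | hx
    · rw [hx, exp_mul_top hlam, ENNReal.mul_top (by simpa using hlam)]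
    · lift v x to ℝ≥0 using hx with r
      rw [exp_mul_coe, ← ENNReal.ofReal_mul (by positivity), ← ENNReal.ofReal_coe_nnreal]
      refine ENNReal.ofReal_le_ofReal ?_
      rw [one_div_mul_eq_div, le_div_iff₀ hlam]
      linarith [Real.add_one_le_exp (lam * r)]
  have h1 : ∫⁻ x, v x ∂μ ≠ ⊤ := by
    refine ne_top_of_le_ne_top ?_ (lintegral_mono hle)
    rw [lintegral_const_mul' _ _ ENNReal.ofReal_ne_top]
    exact ENNReal.mul_ne_top ENNReal.ofReal_ne_top h
  exact (ae_lt_top' hv h1).mono fun x hx => hx.ne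

theorem hasLogGrowth_add_one {n : ℕ} (hn : 2 ≤ n) {Ω : Set (EuclideanSpace ℝ (Fin n))}
    (hΩ : IsOpen Ω) {v : EuclideanSpace ℝ (Fin n) → ℝ≥0∞} {lam : ℝ} {L : ℝ≥0} (hlam : 0 < lam)
    (h : ∫⁻ x in Ω, EReal.exp ((lam : EReal) * (v x : EReal)) ≤ L) :
    HasLogGrowth Ω (fun z => v z + 1) (1 / ((n : ℝ) - 1))
      ((2 * n / lam) ^ (1 / ((n : ℝ) - 1))) (2 / lam * Real.exp lam * L) := by
  have hn1 : (2 : ℝ) ≤ n := by exact_mod_cast hn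
  have hn2 : (0 : ℝ) < n - 1 := by linarith
  refine ⟨fun z => ENNReal.ofReal (2 / lam * Real.exp lam) *
    EReal.exp ((lam : EReal) * (v z : EReal)), ?_, fun a ha z hz hza => ?_⟩
  · rw [lintegral_const_mul' _ _ ENNReal.ofReal_ne_top,
      ENNReal.ofReal_mul (p := 2 / lam * Real.exp lam) (by positivity),
      ENNReal.ofReal_coe_nnreal]
    gcongr
  · have hρ : 0 < dist a z := by
      refine dist_pos.2 ?_
      rintro rfl
      have := hΩ.inter_frontier_eq
      exact (this.subset ⟨hz, ha⟩ : _)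
    have hC : 0 < 2 / lam * Real.exp lam := by positivity
    dsimp only
    rcases eq_or_ne (v z) ⊤ with hx | hx
    · have h1 :
          ENNReal.ofReal (2 / lam * Real.exp lam) * ⊤ * ENNReal.ofReal (dist a z ^ n) = ⊤ := by
        rw [ENNReal.mul_top (ENNReal.ofReal_pos.2 hC).ne',
          ENNReal.top_mul (ENNReal.ofReal_pos.2 (pow_pos hρ n)).ne']
      rw [hx, exp_mul_top hlam, h1, add_top]
      exact le_top
    · lift v z to ℝ≥0 using hx with r
      rw [exp_mul_coe, ← ENNReal.ofReal_mul hC.le, ← ENNReal.ofReal_mul (by positivity),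
        ← ENNReal.ofReal_add (by have := Real.log_nonneg ((one_le_div hρ).2 hza); positivity)
        (by positivity), ← ENNReal.ofReal_coe_nnreal, ← ENNReal.ofReal_one,
        ← ENNReal.ofReal_add (NNReal.coe_nonneg r) one_pos.le,
        ENNReal.ofReal_rpow_of_pos (by positivity)]
      refine ENNReal.ofReal_le_ofReal ?_
      have := rpow_le_log_add_exp (n := n) (s := 1 / ((n : ℝ) - 1)) (V := r + 1) hlam
        (by positivity)
        (by rw [div_le_one hn2]; linarith) (by linarith [NNReal.coe_nonneg r]) hρ hza
      refine this.trans (le_of_eq ?_)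
      rw [mul_add, mul_one, Real.exp_add]
      ring

end JohnCapacity

theorem theorem4p1 (n : ℕ) (hn : 2 ≤ n) (c₀ : ℝ) (hc₀ : 0 < c₀) :
    (∃ C : ℝ≥0, 0 < C ∧
      ∀ (Ω : Set (EuclideanSpace ℝ (Fin n))) (x₀ : EuclideanSpace ℝ (Fin n))
        (W : Set (JohnCapacity.AxisCube n)) (Q₀ : JohnCapacity.AxisCube n)
        (E : Set (EuclideanSpace ℝ (Fin n))),
        JohnCapacity.IsJohnDomain c₀ Ω x₀ → Metric.diam Ω = 1 →
        JohnCapacity.IsWhitneyDecomposition Ω W → Q₀ ∈ W → x₀ ∈ Q₀.carrier →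
        IsCompact E → E ⊆ frontier Ω → 0 < JohnCapacity.gaugeMeasure n E →
        (C : ℝ≥0∞) * JohnCapacity.logInv (JohnCapacity.hausdorffContentOne E) ^ (1 - (n : ℝ))
          ≤ JohnCapacity.capacity E Q₀.carrier Ω) ∧
    (∀ (lam : ℝ) (L : ℝ≥0), 0 < lam → ∃ C : ℝ≥0, 0 < C ∧
      ∀ (Ω : Set (EuclideanSpace ℝ (Fin n))) (x₀ : EuclideanSpace ℝ (Fin n))
        (W : Set (JohnCapacity.AxisCube n)) (Q₀ : JohnCapacity.AxisCube n)
        (E : Set (EuclideanSpace ℝ (Fin n))) (wt : EuclideanSpace ℝ (Fin n) → ℝ≥0∞),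
        JohnCapacity.IsJohnDomain c₀ Ω x₀ → Metric.diam Ω = 1 →
        JohnCapacity.IsWhitneyDecomposition Ω W → Q₀ ∈ W → x₀ ∈ Q₀.carrier →
        IsCompact E → E ⊆ frontier Ω → 0 < JohnCapacity.gaugeMeasure n E →
        AEMeasurable wt (volume.restrict Ω) →
        ∫⁻ x in Ω, EReal.exp ((lam : EReal) * (wt x : EReal)) ≤ (L : ℝ≥0∞) →
        (C : ℝ≥0∞) * JohnCapacity.logInv (JohnCapacity.hausdorffContentOne E) ^ (-(n : ℝ))
          ≤ JohnCapacity.weightedCapacity (fun x => (wt x)⁻¹) E Q₀.carrier Ω) := by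
  have hn1 : (2 : ℝ) ≤ n := by exact_mod_cast hn
  have hn2 : (0 : ℝ) < n - 1 := by linarith
  have hs : 0 ≤ 1 / ((n : ℝ) - 1) := by positivity
  constructor
  · obtain ⟨C, hC, h⟩ := JohnCapacity.exists_energy_lower_bound hn hc₀ le_rfl hs
      zero_le_one (le_refl (0 : ℝ))
    refine ⟨C, hC, fun Ω x₀ W Q₀ E hΩ hd hW hQ hx hE hEF _ =>
      le_iInf fun u => le_iInf fun g => le_iInf fun hug => ?_⟩
    have := h Ω x₀ W Q₀ E (fun _ => 1) u g hΩ hd hW hQ hx hE hEF aemeasurable_const (by simp)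
      (by simp) (JohnCapacity.hasLogGrowth_one Ω) hug
    rw [show -((1 + 0) * ((n : ℝ) - 1)) = 1 - n by ring] at this
    simpa using this
  · intro lam L hlam
    obtain ⟨C, hC, h⟩ := JohnCapacity.exists_energy_lower_bound hn hc₀ hs le_rfl
      (κ := (2 * n / lam) ^ (1 / ((n : ℝ) - 1))) (L := 2 / lam * Real.exp lam * L)
      (by positivity) (by positivity)
    refine ⟨C, hC, fun Ω x₀ W Q₀ E wt hΩ hd hW hQ hx hE hEF _ hwt hexp =>
      le_iInf fun u => le_iInf fun g => le_iInf fun hug => ?_⟩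
    have hfin := JohnCapacity.ae_ne_top_of_lintegral_exp hlam hwt
      (ne_top_of_le_ne_top ENNReal.coe_ne_top hexp)
    -- The weight `wt + 1` does not vanish, and passing to it decreases the energy.
    have := h Ω x₀ W Q₀ E (fun z => wt z + 1) u g hΩ hd hW hQ hx hE hEF (hwt.add_const 1)
      (by simp) (hfin.mono fun z hz => by simpa using hz)
      (JohnCapacity.hasLogGrowth_add_one hn hΩ.isOpen hlam hexp) hug
    rw [show -((1 + 1 / ((n : ℝ) - 1)) * ((n : ℝ) - 1)) = -n by field_simp; ring] at this
    refine this.trans (lintegral_mono fun z => ?_)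
    exact mul_le_mul_right (ENNReal.inv_le_inv.2 le_self_add) _
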